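/- For complex $q$ with $|q|<1$ put $(x;q)_n=\prod_{i=0}^{n-1}(1-q^ix)$ and $(x;q)_\infty=\prod_{i\ge 0}(1-q^ix)$. Further put $$j(x;q)=(x;q)_\infty(q/x;q)_\infty(q;q)_\infty,\qquad J_{a,m}=j(q^a;q^m),\qquad J_m=J_{m,3m},\qquad \overline{J}_{a,m}=j(-q^a;q^m),$$ $$m(x,z;q)=\frac{1}{j(z;q)}\sum_{r\in\mathbb Z}\frac{(-1)^rq^{\binom r2}z^r}{1-q^{r-1}xz},$$ and define the eighth order mock theta function $V_0$ and its Taylor coefficients $g(n)$ by $$V_0(q)=\sum_{n\ge 0}g(n)q^n=-1+2\sum_{n\ge0}\frac{q^{n^2}(-q;q^2)_n}{(q;q^2)_n}\qquad(|q|<1),$$ with $g(n)=0$ for $n<0$. **Theorem.** Let $p\ge 3$ be an odd integer. For all $q$ with $0<|q|<1$, $$V_0(q)=A(q)+\Theta_1(q)+\Theta_3(q),$$ where $$A(q)=-2\sum_{r=0}^{p-1}(-1)^rq^{-(2r+1)^2}\,m\Big(q^{8p\left(\frac{p-1}{2}-r\right)},-1;q^{8p^2}\Big)$$ and, for $s\in\{1,3\}$,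 $$\Theta_s(q)=\frac{J_{8p}^3}{J_{s,8}\overline{J}_{0,8p^2}}\sum_{r=0}^{p-1}\frac{(-1)^rq^{4r(r-p)-1}\,q^{sr-s(p-1)/2}\,j(-q^{8r+s};q^{8p})\,j(-q^{p(8r+s)};q^{8p^2})}{\overline{J}_{0,8p}\,j(q^{8r+s};q^{8p})}.$$ Moreover, $A$, $\Theta_1$ and $\Theta_3$ have Laurent expansions $\sum_{n\in\mathbb Z}a(n)q^n$, $\sum_{n\in\mathbb Z}c_1(n)q^n$ and $\sum_{n\in\mathbb Z}c_3(n)q^n$ on $0<|q|<1$. If $\alpha$ is an integer with $\alpha\not\equiv-(2r+1)^2\pmod{8p}$ for every $r\in\{0,\dots,p-1\}$, then the progression $\sum_{n\ge 0} g(8pn+\alpha)q^{8pn+\alpha}$ receives contributions only from the two theta sums: $a(8pn+\alpha)=0$ and $g(8pn+\alpha)=c_1(8pn+\alpha)+c_3(8pn+\alpha)$ for all $n\in\mathbb Z$, and hence $$\sum_{n\ge0}g(8pn+\alpha)q^{8pn+\alpha}=\sum_{n\ge0}\big(c_1(8pn+\alpha)+c_3(8pn+\alpha)\big)q^{8pn+\alpha}\qquad(0<|q|<1).$$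 -/

import Mathlib

noncomputable section

namespace MockV0

/-- The finite q-Pochhammer symbol `(x; q)_n = ∏_{0 ≤ i < n} (1 - q^i x)`. -/
def qPoch (x q : ℂ) (n : ℕ) : ℂ := ∏ i ∈ Finset.range n, (1 - q ^ i * x)

/-- The infinite q-Pochhammer symbol `(x; q)_∞ = ∏_{i ≥ 0} (1 - q^i x)`, for `|q| < 1`. -/
def qPochInf (x q : ℂ) : ℂ := ∏' i : ℕ, (1 - q ^ i * x)

/-- The theta function `j(x; q) = (x; q)_∞ (q/x; q)_∞ (q; q)_∞`. -/
def j (x q : ℂ) : ℂ := qPochInf x q * qPochInf (q / x) q * qPochInf q q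

/-- `J_{a,m} = j(q^a; q^m)`. -/
def J (a : ℤ) (m : ℕ) (q : ℂ) : ℂ := j (q ^ a) (q ^ m)

/-- `J_m = J_{m,3m}`. -/
def J1 (m : ℕ) (q : ℂ) : ℂ := J m (3 * m) q

/-- `J̄_{a,m} = j(-q^a; q^m)`. -/
def Jbar (a : ℤ) (m : ℕ) (q : ℂ) : ℂ := j (-q ^ a) (q ^ m)

/-- The Appell function
`m(x, z; q) = j(z; q)⁻¹ ∑_{r ∈ ℤ} (-1)^r q^{r(r-1)/2} z^r / (1 - q^{r-1} x z)`. -/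
def m (x z q : ℂ) : ℂ :=
  1 / j z q *
    ∑' r : ℤ, (-1) ^ r * q ^ (r * (r - 1) / 2) * z ^ r / (1 - q ^ (r - 1) * x * z)

/-- The eighth order mock theta function
`V₀(q) = -1 + 2 ∑_{n ≥ 0} q^{n²} (-q; q²)_n / (q; q²)_n`, for `|q| < 1`. -/
def V0 (q : ℂ) : ℂ :=
  -1 + 2 * ∑' n : ℕ, q ^ (n ^ 2) * qPoch (-q) (q ^ 2) n / qPoch q (q ^ 2) n

/-- `g(n)` is the coefficient of `q^n` in the Taylor expansion of `V₀(q)` at `q = 0`; it is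
zero for negative `n`. -/
def g (n : ℤ) : ℂ :=
  if 0 ≤ n then iteratedDeriv n.toNat V0 0 / (n.toNat.factorial : ℂ) else 0

/-- The sum of Appell functions
`-2 ∑_{r=0}^{p-1} (-1)^r q^{-(2r+1)²} m(q^{8p((p-1)/2 - r)}, -1; q^{8p²})` (`p` odd). -/
def appellSum (p : ℕ) (q : ℂ) : ℂ :=
  -2 * ∑ r ∈ Finset.range p,
    (-1) ^ r * q ^ (-(2 * (r : ℤ) + 1) ^ 2) *
      m (q ^ (8 * (p : ℤ) * (((p : ℤ) - 1) / 2 - r))) (-1) (q ^ (8 * p ^ 2))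

/-- The sum of theta quotients
`J_{8p}³ / (J_{s,8} J̄_{0,8p²}) · ∑_{r=0}^{p-1} (-1)^r q^{4r(r-p)-1} q^{s r - s(p-1)/2}
  j(-q^{8r+s}; q^{8p}) j(-q^{p(8r+s)}; q^{8p²}) / (J̄_{0,8p} j(q^{8r+s}; q^{8p}))` (`p` odd),
to be used for `s = 1` and `s = 3`. -/
def thetaSum (p s : ℕ) (q : ℂ) : ℂ :=
  J1 (8 * p) q ^ 3 / (J s 8 q * Jbar 0 (8 * p ^ 2) q) *
    ∑ r ∈ Finset.range p,
      (-1) ^ r * q ^ (4 * (r : ℤ) * ((r : ℤ) - p) - 1) *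
          q ^ ((s : ℤ) * r - (s : ℤ) * (((p : ℤ) - 1) / 2)) *
          j (-q ^ (8 * r + s)) (q ^ (8 * p)) * j (-q ^ (p * (8 * r + s))) (q ^ (8 * p ^ 2)) /
        (Jbar 0 (8 * p) q * j (q ^ (8 * r + s)) (q ^ (8 * p)))

/-- The Laurent series `∑_{n ∈ ℤ} c(n) q^n` converges to `F(q)` for all `0 < |q| < 1`. -/
def IsLaurentExpansion (F : ℂ → ℂ) (c : ℤ → ℂ) : Prop :=
  ∀ q : ℂ, 0 < ‖q‖ → ‖q‖ < 1 → HasSum (fun n : ℤ => c n * q ^ n) (F q)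

end MockV0

end

/-!
The identity comes from writing `V₀` as a sum of two Appell functions,
`V₀(q) = -q⁻¹ (m(1, q; q⁸) + m(1, q³; q⁸))` (`V0_eq_m_add_m`), and splitting each of them into
`p` Appell functions with base `q^{8p²}` and a sum of theta quotients (`m_one_split`).

*The Appell functions.* The series of `V₀` and the series `∑ q^{2n²} (-q²; q⁴)_n / (q; q²)_{2n+1}`
are the values at `x = 1` of two functions of `x` that satisfy the same first order `q`-difference
equation, hence are equal (`tsum_fTerm_eq_tsum_gTerm`). In the second series
`1 / (q; q²)_{2n+1} = 1 / ((q; q⁴)_{n+1} (q³; q⁴)_n)` has a partial fraction expansion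
(`hasSum_partialFraction`); after exchanging summations, the inner sums are of Bailey type and have
a closed form (`baileySum_eq`, `j_mul_baileySum_zero`). This gives the Lerch-type series of
`V0_eq_lerch`, and for `V₀` itself a series with the factors
`(1 + Y) / (1 - Y) = (1 + Y²) / (1 - Y²) + 2Y / (1 - Y²)`, where `Y = q^{4k+1}`. The odd part is a
multiple of `m(1, q²; q⁸)`; the even part is obtained from a Kronecker series `∑ w^k / (1 - y q^k)`
when that is expanded into a double series and summed along diagonals (`hasSum_even_part`). The two
Appell functions `m(1, q; q⁸)` and `m(1, q³; q⁸)` differ from `m(1, q²; q⁸)` by Kronecker series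
too, by the case `p = 1` of the splitting.

*The splitting.* For `|q| < |z| < 1`, both sides of `m_one_split`, multiplied by `j(z; q)`, have
Laurent expansions in `z`. Their coefficients satisfy the same first order recurrence, so they
agree. The theta quotients arise from Kronecker's formula
`∑ w^k / (1 - y q^k) = (q; q)_∞³ j(yw; q) / (j(y; q) j(w; q))` (`lambert_eq`). It is proved by
expanding both factors of `lambert y w q * j(w; q)` in `w`, which leaves an unknown function of `y`
(`lambert_mul_j`). By the symmetry of the double series in `y` and `w`, the product of this function
with `j(y; q)` is constant, and the constant is found by letting `y` tend to `1`
(`poleSeries_mul_j`).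

*The coefficients.* For `q ≠ 0` every theta function that occurs is the restriction of a function
holomorphic and without zeros on the unit disc, and `x ↦ m(x^k, -1; x^p)` is the restriction of a
holomorphic function. Hence `A`, `Θ₁` and `V₀` have Laurent expansions, and that of `Θ₃` follows by
subtraction. The terms of `A` are of the form `q^{-(2r+1)²} F(q^{8p})`, so only exponents congruent
to some `-(2r+1)²` modulo `8p` occur in `A`.
-/

noncomputable section

namespace MockV0

open Filter Topology

/-! ### Pochhammer symbols -/

section Pochhammer

variable {q : ℂ}

lemma summable_norm_pow_mul (hq : ‖q‖ < 1) (x : ℂ) : Summable fun i : ℕ => ‖-(q ^ i * x)‖ := by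
  simp only [norm_neg, norm_mul, norm_pow]
  exact (summable_geometric_of_lt_one (norm_nonneg _) hq).mul_right _

lemma multipliable_qPochInf (hq : ‖q‖ < 1) (x : ℂ) :
    Multipliable fun i : ℕ => 1 - q ^ i * x := by
  simpa only [sub_eq_add_neg] using multipliable_one_add_of_summable (summable_norm_pow_mul hq x)

lemma tendsto_qPoch (hq : ‖q‖ < 1) (x : ℂ) :
    Tendsto (qPoch x q) atTop (𝓝 (qPochInf x q)) :=
  (multipliable_qPochInf hq x).tendsto_prod_tprod_nat

lemma qPochInf_eq_mul (hq : ‖q‖ < 1) (x : ℂ) :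
    qPochInf x q = (1 - x) * qPochInf (q * x) q := by
  have h : Multipliable fun i : ℕ => 1 - q ^ (i + 1) * x := by
    simpa only [pow_succ, mul_assoc] using multipliable_qPochInf hq (q * x)
  have h2 := tprod_eq_zero_mul' (f := fun i : ℕ => 1 - q ^ i * x) h
  simp only [pow_zero, one_mul, pow_succ, mul_assoc] at h2
  exact h2

lemma qPochInf_ne_zero (hq : ‖q‖ < 1) {x : ℂ} (h : ∀ i : ℕ, q ^ i * x ≠ 1) :
    qPochInf x q ≠ 0 := by
  have := tprod_one_add_ne_zero_of_summable (f := fun i : ℕ => -(q ^ i * x))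
    (fun i => by rw [← sub_eq_add_neg]; exact sub_ne_zero.2 (h i).symm) (summable_norm_pow_mul hq x)
  simpa only [qPochInf, sub_eq_add_neg] using this

lemma qPochInf_ne_zero_of_norm_lt (hq : ‖q‖ < 1) {x : ℂ} (hx : ‖x‖ < 1) : qPochInf x q ≠ 0 := by
  refine qPochInf_ne_zero hq fun i h => ?_
  have h1 : ‖q ^ i * x‖ < 1 := by
    rw [norm_mul, norm_pow]
    exact (mul_le_of_le_one_left (norm_nonneg _) (pow_le_one₀ (norm_nonneg _) hq.le)).trans_lt hx
  rw [h, norm_one] at h1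
  exact lt_irrefl _ h1

lemma qPoch_zero (x q : ℂ) : qPoch x q 0 = 1 := by simp [qPoch]

lemma qPoch_succ (x q : ℂ) (n : ℕ) : qPoch x q (n + 1) = qPoch x q n * (1 - q ^ n * x) := by
  rw [qPoch, Finset.prod_range_succ, qPoch]

lemma qPoch_succ' (x q : ℂ) (n : ℕ) : qPoch x q (n + 1) = (1 - x) * qPoch (q * x) q n := by
  rw [qPoch, Finset.prod_range_succ', qPoch]
  simp [pow_succ, mul_assoc, mul_comm]

lemma pow_mul_ne_one (hq : ‖q‖ < 1) {x : ℂ} (hx : ‖x‖ < 1) (i : ℕ) : q ^ i * x ≠ 1 := by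
  intro h
  have h1 : ‖q ^ i * x‖ < 1 := by
    rw [norm_mul, norm_pow]
    exact (mul_le_of_le_one_left (norm_nonneg _) (pow_le_one₀ (norm_nonneg _) hq.le)).trans_lt hx
  rw [h, norm_one] at h1
  exact lt_irrefl _ h1

lemma qPoch_ne_zero (hq : ‖q‖ < 1) {x : ℂ} (hx : ‖x‖ < 1) (n : ℕ) : qPoch x q n ≠ 0 :=
  Finset.prod_ne_zero_iff.2 fun i _ => sub_ne_zero.2 (pow_mul_ne_one hq hx i).symm

lemma norm_qPoch_le (hq : ‖q‖ ≤ 1) {x : ℂ} (hx : ‖x‖ ≤ 1) (n : ℕ) : ‖qPoch x q n‖ ≤ 2 ^ n := by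
  rw [qPoch, norm_prod]
  refine (Finset.prod_le_prod (fun _ _ => norm_nonneg _) (g := fun _ => (2 : ℝ)) fun i _ => ?_).trans_eq
    (by simp)
  refine (norm_sub_le _ _).trans ?_
  rw [norm_one, norm_mul, norm_pow]
  have := mul_le_one₀ (pow_le_one₀ (norm_nonneg q) hq (n := i)) (norm_nonneg x) hx
  linarith

lemma norm_qPoch_inv_le (hq : ‖q‖ ≤ 1) {x : ℂ} {ρ : ℝ} (hx : ‖x‖ ≤ ρ) (hρ : ρ < 1) (n : ℕ) :
    ‖(qPoch x q n)⁻¹‖ ≤ (1 - ρ)⁻¹ ^ n := by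
  rw [qPoch, ← Finset.prod_inv_distrib, norm_prod]
  refine (Finset.prod_le_prod (fun _ _ => norm_nonneg _) (g := fun _ => (1 - ρ)⁻¹)
    fun i _ => ?_).trans_eq (by simp)
  rw [norm_inv]
  refine inv_anti₀ (by linarith) ?_
  have h1 : ‖q ^ i * x‖ ≤ ρ := by
    rw [norm_mul, norm_pow]
    exact (mul_le_of_le_one_left (norm_nonneg _) (pow_le_one₀ (norm_nonneg _) hq)).trans hx
  have h2 := norm_sub_norm_le (1 : ℂ) (q ^ i * x)
  rw [norm_one] at h2
  linarith

/-- The reciprocal `1 / (q; q)_n`, extended by zero to negative `n`. With this convention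
`1 / (q; q)_{n-1} = (1 - q^n) / (q; q)_n` holds for every integer `n`. -/
def qInvFact (q : ℂ) (n : ℤ) : ℂ := if 0 ≤ n then (qPoch q q n.toNat)⁻¹ else 0

lemma qInvFact_natCast (q : ℂ) (n : ℕ) : qInvFact q n = (qPoch q q n)⁻¹ := by simp [qInvFact]

lemma qInvFact_of_neg (q : ℂ) {n : ℤ} (hn : n < 0) : qInvFact q n = 0 := by
  simp [qInvFact, not_le.2 hn]

lemma qInvFact_sub_one (hq : ‖q‖ < 1) (n : ℤ) :
    qInvFact q (n - 1) = (1 - q ^ n) * qInvFact q n := by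
  rcases lt_trichotomy n 0 with h | rfl | h
  · rw [qInvFact_of_neg _ h, qInvFact_of_neg _ (by omega), mul_zero]
  · rw [qInvFact_of_neg _ (by omega)]; simp
  · obtain ⟨k, rfl⟩ : ∃ k : ℕ, n = k + 1 := ⟨(n - 1).toNat, by omega⟩
    have h1 := qPoch_ne_zero hq hq (k + 1)
    rw [qPoch_succ] at h1
    rw [add_sub_cancel_right, qInvFact_natCast]
    have h2 : ((k : ℤ) + 1) = ((k + 1 : ℕ) : ℤ) := by push_cast; rfl
    rw [h2, qInvFact_natCast, qPoch_succ, zpow_natCast, pow_succ]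
    field_simp [left_ne_zero_of_mul h1, right_ne_zero_of_mul h1]

lemma tendsto_qInvFact (hq : ‖q‖ < 1) :
    Tendsto (qInvFact q) atTop (𝓝 (qPochInf q q)⁻¹) := by
  have h := ((tendsto_qPoch hq q).inv₀ (qPochInf_ne_zero_of_norm_lt hq hq)).comp
    (show Tendsto Int.toNat atTop atTop from tendsto_atTop.2 fun n =>
      (eventually_ge_atTop (n : ℤ)).mono fun m hm => by omega)
  refine h.congr' ((eventually_ge_atTop 0).mono fun n hn => ?_)
  simp [qInvFact, hn]

lemma exists_norm_qInvFact_le (hq : ‖q‖ < 1) : ∃ C, ∀ n, ‖qInvFact q n‖ ≤ C := by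
  have h : Tendsto (fun n : ℕ => qInvFact q n) atTop (𝓝 (qPochInf q q)⁻¹) :=
    (tendsto_qInvFact hq).comp tendsto_natCast_atTop_atTop
  obtain ⟨C, hC⟩ := (Metric.isBounded_range_of_tendsto _ h).exists_norm_le
  refine ⟨C, fun n => ?_⟩
  have h0 : 0 ≤ C := (norm_nonneg _).trans (hC _ ⟨0, rfl⟩)
  rcases lt_or_ge n 0 with hn | hn
  · rwa [qInvFact_of_neg _ hn, norm_zero]
  · lift n to ℕ using hn
    exact hC _ ⟨n, rfl⟩

end Pochhammer

/-! ### Theta series and the Jacobi triple product -/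

/-- The general term `(-1)^k q^{k(k-1)/2} z^k` of the theta series of `j(z; q)`. -/
def thetaTerm (z q : ℂ) (k : ℤ) : ℂ := (-1) ^ k * q ^ (k * (k - 1) / 2) * z ^ k

lemma two_mul_tri (k : ℤ) : 2 * (k * (k - 1) / 2) = k * (k - 1) :=
  Int.mul_ediv_cancel' (by simpa [mul_comm] using (Int.even_mul_succ_self (k - 1)).two_dvd)

section Theta

variable {q z : ℂ}

lemma thetaTerm_zero (z q : ℂ) : thetaTerm z q 0 = 1 := by simp [thetaTerm]

lemma thetaTerm_one (z q : ℂ) : thetaTerm z q 1 = -z := by simp [thetaTerm]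

lemma thetaTerm_add_one (hq : q ≠ 0) (hz : z ≠ 0) (k : ℤ) :
    thetaTerm z q (k + 1) = -(q ^ k * z) * thetaTerm z q k := by
  have h : (k + 1) * (k + 1 - 1) / 2 = k + k * (k - 1) / 2 := by
    linarith [two_mul_tri k, two_mul_tri (k + 1)]
  rw [thetaTerm, h, thetaTerm, zpow_add₀ hq, zpow_add_one₀ hz, zpow_add_one₀ (by norm_num)]
  ring

lemma thetaTerm_sub_one (hq : q ≠ 0) (hz : z ≠ 0) (k : ℤ) :
    z * thetaTerm z q (k - 1) = -q ^ (1 - k) * thetaTerm z q k := by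
  have h := thetaTerm_add_one hq hz (k - 1)
  rw [sub_add_cancel] at h
  rw [h, show (1 - k) = -(k - 1) by ring, zpow_neg]
  field_simp [zpow_ne_zero (k - 1) hq]

lemma thetaTerm_ne_zero (hq : q ≠ 0) (hz : z ≠ 0) (k : ℤ) : thetaTerm z q k ≠ 0 :=
  mul_ne_zero (mul_ne_zero (zpow_ne_zero _ (by norm_num)) (zpow_ne_zero _ hq)) (zpow_ne_zero _ hz)

lemma thetaTerm_mul (z w q : ℂ) (k : ℤ) : thetaTerm (z * w) q k = thetaTerm z q k * w ^ k := by
  rw [thetaTerm, thetaTerm, mul_zpow, ← mul_assoc]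

lemma thetaTerm_eq_one_mul (z q : ℂ) (k : ℤ) : thetaTerm z q k = thetaTerm 1 q k * z ^ k := by
  rw [← thetaTerm_mul, one_mul]

lemma thetaTerm_neg (hq : q ≠ 0) (k : ℤ) : thetaTerm z q (-k) = thetaTerm (q / z) q k := by
  have h : -k * (-k - 1) / 2 = k * (k - 1) / 2 + k := by
    linarith [two_mul_tri k, two_mul_tri (-k)]
  rw [thetaTerm, h, thetaTerm, zpow_add₀ hq, div_zpow, zpow_neg, zpow_neg, ← inv_zpow]
  norm_num
  ring

lemma thetaTerm_one_sub (hz : z ≠ 0) (k : ℤ) :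
    thetaTerm z q (1 - k) = -z * thetaTerm z⁻¹ q k := by
  have h : (1 - k) * (1 - k - 1) / 2 = k * (k - 1) / 2 := by
    linarith [two_mul_tri k, two_mul_tri (1 - k)]
  rw [thetaTerm, h, thetaTerm, zpow_sub₀ hz, zpow_sub₀ (by norm_num), inv_zpow, div_eq_mul_inv,
    div_eq_mul_inv, ← inv_zpow (-1 : ℂ)]
  norm_num
  ring

lemma summable_norm_thetaTerm_nat (hq0 : q ≠ 0) (hq : ‖q‖ < 1) (hz : z ≠ 0) :
    Summable fun k : ℕ => ‖thetaTerm z q k‖ := by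
  refine summable_of_ratio_test_tendsto_lt_one (l := 0) zero_lt_one
    (Eventually.of_forall fun k => by simpa using thetaTerm_ne_zero hq0 hz k) ?_
  have : ∀ k : ℕ, ‖‖thetaTerm z q ((k + 1 : ℕ) : ℤ)‖‖ / ‖‖thetaTerm z q k‖‖ = ‖q‖ ^ k * ‖z‖ := by
    intro k
    have h := norm_ne_zero_iff.2 (thetaTerm_ne_zero hq0 hz k)
    push_cast
    rw [thetaTerm_add_one hq0 hz, norm_norm, norm_norm, norm_mul, norm_neg, norm_mul, zpow_natCast,
      norm_pow]
    field_simp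
  simp only [this]
  simpa using (tendsto_pow_atTop_nhds_zero_of_lt_one (norm_nonneg _) hq).mul_const ‖z‖

lemma summable_norm_thetaTerm (hq0 : q ≠ 0) (hq : ‖q‖ < 1) (hz : z ≠ 0) :
    Summable fun k : ℤ => ‖thetaTerm z q k‖ := by
  refine Summable.of_nat_of_neg (summable_norm_thetaTerm_nat hq0 hq hz) ?_
  simp only [thetaTerm_neg hq0]
  exact summable_norm_thetaTerm_nat hq0 hq (div_ne_zero hq0 hz)

lemma _root_.HasSum.of_eq {ι : Type*} {f g : ι → ℂ} {a b : ℂ} (h : HasSum f a)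
    (hfg : ∀ k, g k = f k) (hab : b = a) : HasSum g b := by
  rw [hab, funext hfg]
  exact h

lemma _root_.HasSum.int_shift {f : ℤ → ℂ} {a : ℂ} (h : HasSum f a) (c : ℤ) :
    HasSum (fun k => f (k + c)) a :=
  (Equiv.addRight c).hasSum_iff.2 h

/-- The finite form of the Jacobi triple product:
`(z; q)_n (q/z; q)_n / (q; q)_{2n} = ∑_k (-1)^k q^{k(k-1)/2} z^k / ((q; q)_{n-k} (q; q)_{n+k})`. -/
lemma hasSum_finite_triple_product (hq0 : q ≠ 0) (hq : ‖q‖ < 1) (hz : z ≠ 0) (n : ℕ) :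
    HasSum (fun k : ℤ => thetaTerm z q k * (qInvFact q (n - k) * qInvFact q (n + k)))
      (qPoch z q n * qPoch (q / z) q n * qInvFact q (2 * n)) := by
  induction n with
  | zero =>
    have h := hasSum_single (f := fun k : ℤ =>
      thetaTerm z q k * (qInvFact q ((0 : ℕ) - k) * qInvFact q ((0 : ℕ) + k))) 0 (fun k hk => by
        rcases lt_or_gt_of_ne hk with h | h
        · rw [qInvFact_of_neg q (n := ((0 : ℕ) : ℤ) + k) (by simpa using h)]; simp
        · rw [qInvFact_of_neg q (n := ((0 : ℕ) : ℤ) - k) (by simpa using h)]; simp)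
    simpa [thetaTerm_zero, qPoch_zero, qInvFact] using h
  | succ n ih =>
    have h1 := ((ih.mul_left (1 + q ^ (2 * n + 1))).sub
      ((ih.int_shift (-1)).mul_left (z * q ^ n))).sub
      ((ih.int_shift 1).mul_left (q ^ (n + 1) / z))
    have hA : (1 - q ^ (2 * n + 1)) * (1 - q ^ (2 * n + 2)) ≠ 0 := by
      have : ∀ k : ℕ, 1 - q ^ (k + 1) ≠ 0 := fun k => by
        simpa [pow_succ] using sub_ne_zero.2 (pow_mul_ne_one hq hq k).symm
      exact mul_ne_zero (this _) (this _)
    have h2 := h1.mul_left ((1 - q ^ (2 * n + 1)) * (1 - q ^ (2 * n + 2)))⁻¹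
    refine h2.of_eq (fun k => ?_) ?_
    · rw [eq_inv_mul_iff_mul_eq₀ hA]
      have e1 : qInvFact q (n - k) = (1 - q ^ ((n : ℤ) + 1 - k)) * qInvFact q (n + 1 - k) := by
        rw [← qInvFact_sub_one hq]; ring_nf
      have e2 : qInvFact q (n + k) = (1 - q ^ ((n : ℤ) + 1 + k)) * qInvFact q (n + 1 + k) := by
        rw [← qInvFact_sub_one hq]; ring_nf
      have e3 : qInvFact q (n - (k + 1)) = (1 - q ^ ((n : ℤ) - k)) * qInvFact q (n - k) := by
        rw [← qInvFact_sub_one hq]; ring_nf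
      have e4 : qInvFact q (n + (k + -1)) = (1 - q ^ ((n : ℤ) + k)) * qInvFact q (n + k) := by
        rw [← qInvFact_sub_one hq]; ring_nf
      have e5 : qInvFact q (n - (k + -1)) = qInvFact q (n + 1 - k) := by ring_nf
      have e6 : qInvFact q (n + (k + 1)) = qInvFact q (n + 1 + k) := by ring_nf
      have t1 : z * thetaTerm z q (k + -1) = -q ^ (1 - k) * thetaTerm z q k :=
        thetaTerm_sub_one hq0 hz k
      have t2 := thetaTerm_add_one hq0 hz k
      have p1 : q ^ ((n : ℤ) + 1 - k) = q ^ n * q ^ (1 - k) := by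
        rw [← zpow_natCast, ← zpow_add₀ hq0]; ring_nf
      have p2 : q ^ ((n : ℤ) + 1 + k) = q ^ n * q * q ^ k := by
        rw [← zpow_natCast, ← zpow_add_one₀ hq0, ← zpow_add₀ hq0]
      have p3 : q ^ ((n : ℤ) - k) = q ^ n * q ^ (1 - k) / q := by
        rw [← p1, eq_div_iff hq0, ← zpow_add_one₀ hq0]; ring_nf
      have p4 : q ^ ((n : ℤ) + k) = q ^ n * q ^ k := by
        rw [← zpow_natCast, ← zpow_add₀ hq0]
      have p5 : q ^ (1 - k) * q ^ k = q := by
        rw [← zpow_add₀ hq0]; simp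
      push_cast
      rw [e3, e4, e5, e6, e1, e2, t2, p1, p2, p3, p4]
      rw [show ∀ X : ℂ, z * q ^ n * (thetaTerm z q (k + -1) * X) =
        (z * thetaTerm z q (k + -1)) * (q ^ n * X) by intro X; ring, t1]
      generalize qInvFact q (n + 1 - k) = R
      generalize qInvFact q (n + 1 + k) = S
      generalize thetaTerm z q k = T
      have hk : q ^ (1 - k) ≠ 0 := zpow_ne_zero _ hq0
      have p6 : q ^ k = q / q ^ (1 - k) := by rw [eq_div_iff hk, mul_comm, p5]
      rw [p6]
      generalize q ^ (1 - k) = a at hk ⊢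
      field_simp
      ring
    · rw [eq_inv_mul_iff_mul_eq₀ hA, qPoch_succ, qPoch_succ]
      have e1 := qInvFact_sub_one hq (2 * ((n + 1 : ℕ) : ℤ))
      have e2 := qInvFact_sub_one hq (2 * ((n + 1 : ℕ) : ℤ) - 1)
      have e3 : 2 * ((n + 1 : ℕ) : ℤ) - 1 - 1 = 2 * n := by push_cast; ring
      have p1 : q ^ (2 * ((n + 1 : ℕ) : ℤ)) = q ^ (2 * n + 2) := by
        rw [← zpow_natCast]; congr 1
      have p2 : q ^ (2 * ((n + 1 : ℕ) : ℤ) - 1) = q ^ (2 * n + 1) := by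
        rw [← zpow_natCast]; congr 1; push_cast; ring
      rw [e3, e1, p1, p2] at e2
      rw [e2]
      field_simp
      ring

/-- **Jacobi triple product identity.** -/
theorem hasSum_thetaTerm (hq0 : q ≠ 0) (hq : ‖q‖ < 1) (hz : z ≠ 0) :
    HasSum (thetaTerm z q) (j z q) := by
  have hs := summable_norm_thetaTerm hq0 hq hz
  obtain ⟨C, hC⟩ := exists_norm_qInvFact_le hq
  have hC0 : 0 ≤ C := (norm_nonneg _).trans (hC 0)
  have hP := qPochInf_ne_zero_of_norm_lt hq hq
  have hr (f : ℕ → ℤ) (hf : Tendsto f atTop atTop) :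
      Tendsto (fun n => qInvFact q (f n)) atTop (𝓝 (qPochInf q q)⁻¹) := (tendsto_qInvFact hq).comp hf
  have hn : Tendsto (fun n : ℕ => (n : ℤ)) atTop atTop := tendsto_natCast_atTop_atTop
  have h1 : Tendsto (fun n : ℕ => ∑' k : ℤ, thetaTerm z q k * (qInvFact q (n - k) *
      qInvFact q (n + k))) atTop (𝓝 (∑' k : ℤ, thetaTerm z q k * ((qPochInf q q)⁻¹ *
      (qPochInf q q)⁻¹))) := by
    refine tendsto_tsum_of_dominated_convergence (hs.mul_right (C * C)) (fun k => ?_)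
      (Eventually.of_forall fun n k => ?_)
    · refine ((hr _ ?_).mul (hr _ ?_)).const_mul _
      · exact tendsto_atTop_add_const_right _ (-k) hn
      · exact tendsto_atTop_add_const_right _ k hn
    · rw [norm_mul, norm_mul]
      gcongr
      · exact hC _
      · exact hC _
  have h2 : Tendsto (fun n : ℕ => qPoch z q n * qPoch (q / z) q n * qInvFact q (2 * n)) atTop
      (𝓝 (qPochInf z q * qPochInf (q / z) q * (qPochInf q q)⁻¹)) :=
    ((tendsto_qPoch hq z).mul (tendsto_qPoch hq _)).mul
      (hr _ (hn.const_mul_atTop' (by norm_num)))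
  have h3 := tendsto_nhds_unique h1
    (h2.congr fun n => (hasSum_finite_triple_product hq0 hq hz n).tsum_eq.symm)
  rw [tsum_mul_right] at h3
  have h4 : ∑' k, thetaTerm z q k = j z q := by
    rw [j]
    field_simp at h3
    linear_combination h3
  rw [← h4]
  exact hs.of_norm.hasSum

lemma j_ne_zero (hq : ‖q‖ < 1) (h1 : ‖q‖ < ‖z‖) (h2 : ‖z‖ ≤ 1) (h3 : z ≠ 1) : j z q ≠ 0 := by
  have hz : 0 < ‖z‖ := (norm_nonneg _).trans_lt h1
  refine mul_ne_zero (mul_ne_zero ?_ ?_) (qPochInf_ne_zero_of_norm_lt hq hq)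
  · rw [qPochInf_eq_mul hq]
    refine mul_ne_zero (sub_ne_zero.2 h3.symm) (qPochInf_ne_zero_of_norm_lt hq ?_)
    rw [norm_mul]
    exact (mul_le_of_le_one_right (norm_nonneg _) h2).trans_lt hq
  · refine qPochInf_ne_zero_of_norm_lt hq ?_
    rwa [norm_div, div_lt_one hz]

lemma j_one (q : ℂ) : j 1 q = 0 := by
  have : qPochInf 1 q = 0 := by
    rw [qPochInf]
    exact tprod_of_exists_eq_zero ⟨0, by simp⟩
  rw [j, this]; simp

lemma j_mul_left (hq0 : q ≠ 0) (hq : ‖q‖ < 1) (hz : z ≠ 0) : z * j (q * z) q = -j z q := by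
  have h1 := (hasSum_thetaTerm hq0 hq (mul_ne_zero hq0 hz)).mul_left z
  refine h1.unique (((hasSum_thetaTerm hq0 hq hz).int_shift 1).neg.of_eq (fun k => ?_) rfl)
  rw [thetaTerm_add_one hq0 hz, mul_comm q z, thetaTerm_mul]
  ring

lemma j_inv (hq0 : q ≠ 0) (hq : ‖q‖ < 1) (hz : z ≠ 0) : z * j z⁻¹ q = -j z q := by
  have h1 := (hasSum_thetaTerm hq0 hq (inv_ne_zero hz)).mul_left (-z)
  have h2 := (Equiv.subLeft (1 : ℤ)).hasSum_iff.2 (hasSum_thetaTerm hq0 hq hz)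
  have h3 : -z * j z⁻¹ q = j z q := h1.unique (h2.of_eq (fun k => by simp [thetaTerm_one_sub hz]) rfl)
  linear_combination -h3

end Theta

/-! ### Bilateral Cauchy products and hyperbolic double sums -/

/-- A bilateral Cauchy product: the double series `∑_{k,t} f(k) g(t)` is summed along the lines
`k + n t - c = N`. -/
lemma hasSum_cauchyProduct {f g : ℤ → ℂ} {a b : ℂ} (hf : HasSum f a) (hg : HasSum g b)
    (hf' : Summable fun k => ‖f k‖) (hg' : Summable fun k => ‖g k‖) (c n : ℤ) :
    HasSum (fun N => ∑' t, f (N + c - n * t) * g t) (a * b) := by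
  have h1 : HasSum (fun p : ℤ × ℤ => f p.1 * g p.2) (a * b) :=
    hf.mul hg (summable_mul_of_summable_norm hf' hg')
  let e : ℤ × ℤ ≃ ℤ × ℤ :=
    { toFun := fun p => (p.1 + c - n * p.2, p.2)
      invFun := fun p => (p.1 - c + n * p.2, p.2)
      left_inv := fun p => Prod.ext (by simp only []; ring) rfl
      right_inv := fun p => Prod.ext (by simp only []; ring) rfl }
  have h2 : HasSum (fun p : ℤ × ℤ => f (p.1 + c - n * p.2) * g p.2) (a * b) :=
    e.hasSum_iff.2 h1
  exact h2.prod_fiberwise fun N => (h2.summable.prod_factor N).hasSum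

/-- The sign `1` for `k, l ≥ 0`, `-1` for `k, l < 0` and `0` otherwise, by which geometric
expansions of bilateral series with simple poles are weighted. -/
def hypSign (k l : ℤ) : ℂ := if 0 ≤ k ∧ 0 ≤ l then 1 else if k < 0 ∧ l < 0 then -1 else 0

lemma hypSign_comm (k l : ℤ) : hypSign k l = hypSign l k := by
  simp only [hypSign, and_comm]

lemma hasSum_hypSign_mul_zpow {k : ℤ} {u : ℂ} (h1 : 0 ≤ k → ‖u‖ < 1) (h2 : k < 0 → 1 < ‖u‖) :
    HasSum (fun l : ℤ => hypSign k l * u ^ l) (1 / (1 - u)) := by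
  rcases lt_or_ge k 0 with hk | hk
  · have hu := h2 hk
    have hu0 : u ≠ 0 := by rintro rfl; simp at hu; linarith
    have hu1 : 1 - u ≠ 0 := by
      intro h; rw [sub_eq_zero] at h; rw [← h, norm_one] at hu; exact lt_irrefl _ hu
    have h3 := (hasSum_geometric_of_norm_lt_one (ξ := u⁻¹)
      (by rw [norm_inv]; exact inv_lt_one_of_one_lt₀ hu)).mul_left (-u⁻¹)
    have h4 := HasSum.of_nat_of_neg_add_one (f := fun l : ℤ => hypSign k l * u ^ l) (m := 0)
      (m' := -u⁻¹ * (1 - u⁻¹)⁻¹) (by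
        refine hasSum_zero.of_eq (fun n => ?_) rfl
        simp [hypSign, hk, hk.not_ge]) (by
        refine h3.of_eq (fun n => ?_) rfl
        have : hypSign k (-((n : ℤ) + 1)) = -1 := by
          rw [hypSign, if_neg (by omega), if_pos (by omega)]
        rw [this, zpow_neg, zpow_add_one₀ hu0, zpow_natCast, inv_pow, mul_inv]
        ring)
    refine h4.of_eq (fun _ => rfl) ?_
    have : u - 1 ≠ 0 := by rw [← neg_ne_zero, neg_sub]; exact hu1
    field_simp
    ring
  · have h4 := HasSum.of_nat_of_neg_add_one (f := fun l : ℤ => hypSign k l * u ^ l) (m' := 0)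
      (m := (1 - u)⁻¹) (by
        refine (hasSum_geometric_of_norm_lt_one (h1 hk)).of_eq (fun n => ?_) rfl
        simp [hypSign, hk]) (by
        refine hasSum_zero.of_eq (fun n => ?_) rfl
        rw [hypSign, if_neg (by omega), if_neg (by omega), zero_mul])
    exact h4.of_eq (fun _ => rfl) (by simp)

lemma summable_zpow_of_annulus {q w : ℝ} (hq0 : 0 < q) (h1 : q < w) (h2 : w < 1) :
    Summable fun k : ℤ => if 0 ≤ k then w ^ k else (w / q) ^ k := by
  have hw : 0 < w := hq0.trans h1
  refine Summable.of_nat_of_neg_add_one ?_ ?_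
  · simpa using summable_geometric_of_lt_one hw.le h2
  · have h3 := ((summable_geometric_of_lt_one (div_pos hq0 hw).le ((div_lt_one hw).2 h1)).mul_left
      (q / w))
    refine h3.congr fun n => ?_
    rw [if_neg (by omega), zpow_neg, ← inv_zpow, inv_div, zpow_add_one₀ (div_pos hq0 hw).ne',
      zpow_natCast, mul_comm]

lemma summable_norm_hyp {q w y : ℂ} (hq0 : q ≠ 0) (hw : ‖q‖ < ‖w‖) (hw1 : ‖w‖ < 1)
    (hy : ‖q‖ < ‖y‖) (hy1 : ‖y‖ < 1) :
    Summable fun p : ℤ × ℤ => ‖hypSign p.1 p.2 * (w ^ p.1 * y ^ p.2 * q ^ (p.1 * p.2))‖ := by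
  have hq : 0 < ‖q‖ := norm_pos_iff.2 hq0
  have hq1 : ‖q‖ < 1 := hw.trans hw1
  have hw0 : 0 < ‖w‖ := hq.trans hw
  have hy0 : 0 < ‖y‖ := hq.trans hy
  have hpos (v : ℝ) (hv : 0 < v) (k : ℤ) : 0 ≤ if 0 ≤ k then v ^ k else (v / ‖q‖) ^ k := by
    split_ifs <;> positivity
  have h := ((summable_zpow_of_annulus hq hw hw1).mul_of_nonneg
    (summable_zpow_of_annulus hq hy hy1) (hpos _ hw0) (hpos _ hy0)).mul_left ‖q‖⁻¹
  refine h.of_nonneg_of_le (fun _ => norm_nonneg _) fun p => ?_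
  obtain ⟨k, l⟩ := p
  simp only [norm_mul, norm_zpow]
  by_cases h1 : 0 ≤ k ∧ 0 ≤ l
  · rw [hypSign, if_pos h1, if_pos h1.1, if_pos h1.2, norm_one, one_mul]
    rw [mul_comm]
    gcongr
    refine le_trans ?_ (one_le_inv_iff₀.2 ⟨hq, hq1.le⟩)
    exact zpow_le_one₀ hq hq1.le (mul_nonneg h1.1 h1.2)
  · by_cases h2 : k < 0 ∧ l < 0
    · rw [hypSign, if_neg h1, if_pos h2, if_neg h2.1.not_ge, if_neg h2.2.not_ge, norm_neg, norm_one,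
        one_mul, div_zpow, div_zpow]
      have h3 : ‖q‖⁻¹ * (‖w‖ ^ k / ‖q‖ ^ k * (‖y‖ ^ l / ‖q‖ ^ l)) =
          ‖w‖ ^ k * ‖y‖ ^ l * ‖q‖ ^ (-1 - k - l) := by
        rw [zpow_sub₀ hq.ne', zpow_sub₀ hq.ne', zpow_neg_one]
        field_simp
      rw [h3]
      gcongr ?_ * ?_
      refine zpow_le_zpow_right_of_le_one₀ hq hq1.le ?_
      nlinarith [mul_nonneg (show 0 ≤ -1 - k by omega) (show 0 ≤ -1 - l by omega)]
    · rw [hypSign, if_neg h1, if_neg h2, norm_zero, zero_mul]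
      exact mul_nonneg (inv_nonneg.2 hq.le) (mul_nonneg (hpos _ hw0 _) (hpos _ hy0 _))

/-! ### Kronecker's partial fraction formula -/

/-- Kronecker's bilateral Lambert series `∑_{k ∈ ℤ} w^k / (1 - y q^k)`. -/
def lambert (y w q : ℂ) : ℂ := ∑' k : ℤ, w ^ k / (1 - y * q ^ k)

section Kronecker

variable {q y w : ℂ}

lemma exists_norm_inv_one_sub_le (hq0 : q ≠ 0) (hq : ‖q‖ < 1) (hy : y ≠ 0) :
    ∃ C, ∀ k : ℤ, ‖(1 - y * q ^ k)⁻¹‖ ≤ C ∧ ‖(1 - y * q ^ k)⁻¹‖ ≤ C * ‖q‖ ^ (-k) := by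
  have hq' : 0 < ‖q‖ := norm_pos_iff.2 hq0
  have hlim := tendsto_pow_atTop_nhds_zero_of_norm_lt_one hq
  have h1 : Tendsto (fun n : ℕ => (1 - y * q ^ n)⁻¹) atTop (𝓝 (1 - y * 0)⁻¹) :=
    (tendsto_const_nhds.sub (hlim.const_mul y)).inv₀ (by simp)
  have h2 : Tendsto (fun n : ℕ => (q ^ n - y)⁻¹) atTop (𝓝 (0 - y)⁻¹) :=
    (hlim.sub_const y).inv₀ (by simpa using hy)
  obtain ⟨C, hC⟩ := (Metric.isBounded_range_of_tendsto _ h1).exists_norm_le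
  obtain ⟨D, hD⟩ := (Metric.isBounded_range_of_tendsto _ h2).exists_norm_le
  have hC0 : 0 ≤ C := (norm_nonneg _).trans (hC _ ⟨0, rfl⟩)
  have hD0 : 0 ≤ D := (norm_nonneg _).trans (hD _ ⟨0, rfl⟩)
  refine ⟨max C D, fun k => ?_⟩
  have hM : 0 ≤ max C D := hC0.trans (le_max_left _ _)
  rcases le_or_gt 0 k with hk | hk
  · lift k to ℕ using hk
    have h3 : ‖(1 - y * q ^ (k : ℤ))⁻¹‖ ≤ max C D := by
      rw [zpow_natCast]
      exact (hC _ ⟨k, rfl⟩).trans (le_max_left _ _)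
    refine ⟨h3, h3.trans (le_mul_of_one_le_right hM ?_)⟩
    exact one_le_zpow_of_nonpos₀ hq' hq.le (by omega)
  · obtain ⟨n, rfl⟩ : ∃ n : ℕ, k = -n := ⟨(-k).toNat, by omega⟩
    have h3 : (1 - y * q ^ (-(n : ℤ)))⁻¹ = q ^ n * (q ^ n - y)⁻¹ := by
      rw [zpow_neg, zpow_natCast]
      have := pow_ne_zero n hq0
      rw [show 1 - y * (q ^ n)⁻¹ = (q ^ n - y) / q ^ n by field_simp, inv_div]
      rfl
    have h4 : ‖(1 - y * q ^ (-(n : ℤ)))⁻¹‖ ≤ max C D * ‖q‖ ^ n := by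
      rw [h3, norm_mul, norm_pow, mul_comm]
      gcongr
      exact (hD _ ⟨n, rfl⟩).trans (le_max_right _ _)
    refine ⟨h4.trans (mul_le_of_le_one_right hM (pow_le_one₀ hq'.le hq.le)), ?_⟩
    simpa using h4

lemma ne_zero_of_norm_lt (h : ‖q‖ < ‖w‖) : w ≠ 0 :=
  norm_pos_iff.1 ((norm_nonneg _).trans_lt h)

lemma summable_norm_lambert (hq0 : q ≠ 0) (hw : ‖q‖ < ‖w‖) (hw1 : ‖w‖ < 1) (hy : y ≠ 0) :
    Summable fun k : ℤ => ‖w ^ k / (1 - y * q ^ k)‖ := by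
  have hw0 := norm_pos_iff.2 (ne_zero_of_norm_lt hw)
  obtain ⟨C, hC⟩ := exists_norm_inv_one_sub_le hq0 (hw.trans hw1) hy
  refine ((summable_zpow_of_annulus (norm_pos_iff.2 hq0) hw hw1).mul_right C).of_nonneg_of_le
    (fun _ => norm_nonneg _) fun k => ?_
  rw [div_eq_mul_inv, norm_mul, norm_zpow]
  split_ifs with hk
  · gcongr
    exact (hC k).1
  · rw [div_zpow, div_eq_mul_inv, mul_assoc, ← zpow_neg, mul_comm _ C]
    gcongr
    exact (hC k).2

lemma hasSum_lambert (hq0 : q ≠ 0) (hw : ‖q‖ < ‖w‖) (hw1 : ‖w‖ < 1) (hy : y ≠ 0) :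
    HasSum (fun k : ℤ => w ^ k / (1 - y * q ^ k)) (lambert y w q) :=
  (summable_norm_lambert hq0 hw hw1 hy).of_norm.hasSum

lemma norm_mul_zpow_lt {u w : ℂ} (hu0 : u ≠ 0) (hu : ‖u‖ < 1) (hw1 : ‖w‖ < 1) {k : ℤ}
    (hk : 0 ≤ k) : ‖w * u ^ k‖ < 1 := by
  rw [norm_mul, norm_zpow]
  exact (mul_le_of_le_one_right (norm_nonneg _)
    (zpow_le_one₀ (norm_pos_iff.2 hu0) hu.le hk)).trans_lt hw1

lemma one_lt_norm_mul_zpow {u w : ℂ} (hu0 : u ≠ 0) (hu : ‖u‖ < 1) (hw : ‖u‖ < ‖w‖) {k : ℤ}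
    (hk : k < 0) : 1 < ‖w * u ^ k‖ := by
  have hu' : 0 < ‖u‖ := norm_pos_iff.2 hu0
  rw [norm_mul, norm_zpow]
  have h1 : ‖u‖ ^ (-1 : ℤ) ≤ ‖u‖ ^ k := zpow_le_zpow_right_of_le_one₀ hu' hu.le (by omega)
  rw [zpow_neg_one] at h1
  calc 1 = ‖u‖ * ‖u‖⁻¹ := (mul_inv_cancel₀ hu'.ne').symm
    _ < ‖w‖ * ‖u‖⁻¹ := by gcongr
    _ ≤ ‖w‖ * ‖u‖ ^ k := by gcongr

lemma hasSum_hyp (hq0 : q ≠ 0) (hy : ‖q‖ < ‖y‖) (hy1 : ‖y‖ < 1) (w : ℂ) (k : ℤ) :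
    HasSum (fun l : ℤ => hypSign k l * (w ^ k * y ^ l * q ^ (k * l)))
      (w ^ k / (1 - y * q ^ k)) := by
  have h := (hasSum_hypSign_mul_zpow (k := k) (u := y * q ^ k) (fun hk => ?_)
    (fun hk => ?_)).mul_left (w ^ k)
  · refine h.of_eq (fun l => ?_) (by rw [mul_one_div])
    rw [mul_zpow, zpow_mul]
    ring
  · exact norm_mul_zpow_lt hq0 (hy.trans hy1) hy1 hk
  · exact one_lt_norm_mul_zpow hq0 (hy.trans hy1) hy hk

/-- `lambert y w q` is the sum of the double series of `w^k y^l q^{kl}` over `k, l ≥ 0`, minus that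
over `k, l < 0`. -/
lemma hasSum_hyp_prod (hq0 : q ≠ 0) (hw : ‖q‖ < ‖w‖) (hw1 : ‖w‖ < 1)
    (hy : ‖q‖ < ‖y‖) (hy1 : ‖y‖ < 1) :
    HasSum (fun p : ℤ × ℤ => hypSign p.1 p.2 * (w ^ p.1 * y ^ p.2 * q ^ (p.1 * p.2)))
      (lambert y w q) := by
  have hs := (summable_norm_hyp hq0 hw hw1 hy hy1).of_norm
  rw [lambert, (hs.hasSum.prod_fiberwise (hasSum_hyp hq0 hy hy1 w)).tsum_eq]
  exact hs.hasSum

lemma lambert_comm (hq0 : q ≠ 0) (hw : ‖q‖ < ‖w‖) (hw1 : ‖w‖ < 1)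
    (hy : ‖q‖ < ‖y‖) (hy1 : ‖y‖ < 1) : lambert y w q = lambert w y q := by
  refine (hasSum_hyp_prod hq0 hw hw1 hy hy1).unique
    (((Equiv.prodComm ℤ ℤ).hasSum_iff.2 (hasSum_hyp_prod hq0 hy hy1 hw hw1)).of_eq (fun p => ?_) rfl)
  simp only [Function.comp, Equiv.prodComm_apply, Prod.swap, hypSign_comm p.1 p.2,
    mul_comm p.1 p.2]
  ring

/-- A bilateral sequence with the recurrence of the theta coefficients is a multiple of them. -/
lemma eq_thetaTerm_mul (hq0 : q ≠ 0) (hy : y ≠ 0) {u : ℤ → ℂ}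
    (h : ∀ N, u (N + 1) = -(q ^ N * y) * u N) (N : ℤ) : u N = thetaTerm y q N * u 0 := by
  induction N using Int.induction_on with
  | zero => rw [thetaTerm_zero, one_mul]
  | succ n ih => rw [h, ih, thetaTerm_add_one hq0 hy, mul_assoc]
  | pred n ih =>
    have h1 := h (-n - 1)
    have h2 := thetaTerm_add_one hq0 hy (-n - 1)
    rw [sub_add_cancel] at h1 h2
    have h3 : -(q ^ (-(n : ℤ) - 1) * y) ≠ 0 :=
      neg_ne_zero.2 (mul_ne_zero (zpow_ne_zero _ hq0) hy)
    rw [h1, h2, mul_assoc] at ih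
    exact mul_left_cancel₀ h3 ih

/-- The series `∑_t (-1)^t q^{t(t-1)/2} / (1 - y q^{-t})`, the partial fraction expansion of
`(q; q)_∞³ / j(y; q)`. -/
def poleSeries (y q : ℂ) : ℂ := ∑' t : ℤ, thetaTerm 1 q t / (1 - y * q ^ (-t))

lemma summable_poleSeries (hq0 : q ≠ 0) (hq : ‖q‖ < 1) (hy : y ≠ 0) (N : ℤ) :
    Summable fun t : ℤ => thetaTerm 1 q t / (1 - y * q ^ (N - t)) := by
  obtain ⟨C, hC⟩ := exists_norm_inv_one_sub_le hq0 hq hy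
  refine Summable.of_norm_bounded ((summable_norm_thetaTerm hq0 hq one_ne_zero).mul_right C)
    fun t => ?_
  rw [div_eq_mul_inv, norm_mul]
  gcongr
  exact (hC _).1

/-- The coefficients of the product of the Lambert series and the theta series in `w` satisfy the
recurrence of theta coefficients because `j(q; q) = 0`. -/
lemma lambert_mul_j (hq0 : q ≠ 0) (hw : ‖q‖ < ‖w‖) (hw1 : ‖w‖ < 1) (hy : y ≠ 0)
    (hy' : ∀ k : ℤ, y * q ^ k ≠ 1) :
    lambert y w q * j w q = poleSeries y q * j (y * w) q := by
  have hq : ‖q‖ < 1 := hw.trans hw1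
  have hw0 : w ≠ 0 := ne_zero_of_norm_lt hw
  have hne (k : ℤ) : 1 - y * q ^ k ≠ 0 := sub_ne_zero.2 (hy' k).symm
  set c : ℤ → ℂ := fun N => ∑' t : ℤ, thetaTerm 1 q t / (1 - y * q ^ (N - t)) with hc
  have hrec : ∀ N, c (N + 1) = -(q ^ N * y) * c N := by
    intro N
    have h1 := ((summable_poleSeries hq0 hq hy (N + 1)).hasSum).int_shift 1
    have h2 := ((summable_poleSeries hq0 hq hy N).hasSum).mul_left (q ^ N * y)
    have h3 := hasSum_thetaTerm hq0 hq hq0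
    have h4 := j_mul_left hq0 hq one_ne_zero
    rw [j_one, mul_one, one_mul, neg_zero] at h4
    rw [h4] at h3
    have h5 := (h1.add h2).unique (h3.neg.of_eq (fun t => ?_) rfl)
    · rw [neg_zero] at h5
      rw [hc]
      linear_combination h5
    · rw [show N + 1 - (t + 1) = N - t by ring, thetaTerm_add_one hq0 one_ne_zero,
        thetaTerm_eq_one_mul q]
      have h6 : q ^ N = q ^ t * q ^ (N - t) := by rw [← zpow_add₀ hq0]; ring_nf
      have h7 := hne (N - t)
      rw [h6]
      field_simp
      ring
  have h1 := hasSum_cauchyProduct (hasSum_lambert hq0 hw hw1 hy) (hasSum_thetaTerm hq0 hq hw0)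
    (summable_norm_lambert hq0 hw hw1 hy) (summable_norm_thetaTerm hq0 hq hw0) 0 1
  refine h1.unique (((hasSum_thetaTerm hq0 hq (mul_ne_zero hy hw0)).mul_left _).of_eq
    (fun N => ?_) rfl)
  have h2 : c N = thetaTerm y q N * poleSeries y q := by
    have h0 : c 0 = poleSeries y q := by simp [hc, poleSeries]
    rw [eq_thetaTerm_mul hq0 hy hrec N, h0]
  rw [thetaTerm_mul, ← mul_assoc, mul_comm (poleSeries y q), ← h2, hc, ← tsum_mul_right]
  refine tsum_congr fun t => ?_
  rw [thetaTerm_eq_one_mul w, add_zero, one_mul, zpow_sub₀ hw0]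
  have := hne (N - t)
  have := zpow_ne_zero t hw0
  field_simp

lemma mul_zpow_ne_one (hq0 : q ≠ 0) (hy : ‖q‖ < ‖y‖) (hy1 : ‖y‖ ≤ 1) (hy2 : y ≠ 1) (k : ℤ) :
    y * q ^ k ≠ 1 := by
  intro h
  have hq' : 0 < ‖q‖ := norm_pos_iff.2 hq0
  have hn : ‖y‖ * ‖q‖ ^ k = 1 := by rw [← norm_zpow, ← norm_mul, h, norm_one]
  rcases lt_trichotomy k 0 with hk | rfl | hk
  · have h1 : ‖q‖ ^ (-1 : ℤ) ≤ ‖q‖ ^ k :=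
      zpow_le_zpow_right_of_le_one₀ hq' (hy.le.trans hy1) (by omega)
    rw [zpow_neg_one] at h1
    have : 1 < ‖y‖ * ‖q‖ ^ k :=
      calc 1 = ‖q‖ * ‖q‖⁻¹ := (mul_inv_cancel₀ hq'.ne').symm
        _ < ‖y‖ * ‖q‖⁻¹ := by gcongr
        _ ≤ ‖y‖ * ‖q‖ ^ k := by gcongr
    linarith
  · simp at h; exact hy2 h
  · have h1 : ‖q‖ ^ k ≤ ‖q‖ ^ (1 : ℤ) :=
      zpow_le_zpow_right_of_le_one₀ hq' (hy.le.trans hy1) (by omega)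
    rw [zpow_one] at h1
    have : ‖y‖ * ‖q‖ ^ k < 1 :=
      calc ‖y‖ * ‖q‖ ^ k ≤ 1 * ‖q‖ := by gcongr
        _ < 1 := by rw [one_mul]; exact hy.trans_le hy1
    linarith

/-- `(1 - y) poleSeries(y)`, with its removable singularity at `y = 1` removed. -/
def regPoleSeries (y q : ℂ) : ℂ :=
  ∑' t : ℤ, thetaTerm 1 q t * if t = 0 then 1 else (1 - y) / (1 - y * q ^ (-t))

lemma regPoleSeries_eq (hy : y ≠ 1) : regPoleSeries y q = (1 - y) * poleSeries y q := by
  rw [regPoleSeries, poleSeries, ← tsum_mul_left]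
  refine tsum_congr fun t => ?_
  split_ifs with ht
  · subst ht
    have : 1 - y ≠ 0 := sub_ne_zero.2 hy.symm
    simp
    field_simp
  · ring

lemma regPoleSeries_one : regPoleSeries 1 q = 1 := by
  rw [regPoleSeries, tsum_eq_single 0 fun t ht => by simp [ht]]
  simp [thetaTerm_zero]

lemma continuousAt_regPoleSeries (hq0 : q ≠ 0) (hq : ‖q‖ < 1) {u : ℂ} (hu : ‖u‖ = 1) :
    ContinuousAt (fun y => regPoleSeries y q) u := by
  have hq' : 0 < ‖q‖ := norm_pos_iff.2 hq0
  set δ : ℝ := (1 - ‖q‖) / 2 with hδ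
  have hδ0 : 0 < δ := by rw [hδ]; linarith
  set M : ℝ := (1 + ‖q‖) / 2 / ‖q‖ with hM
  have hM1 : 1 < M := by rw [hM, lt_div_iff₀ hq']; linarith
  -- for `t ≠ 0` the denominators stay away from zero in a neighbourhood of the unit circle
  have hden : ∀ y : ℂ, (1 + ‖q‖) / 2 < ‖y‖ → ‖y‖ < M → ∀ t : ℤ, t ≠ 0 →
      δ ≤ ‖1 - y * q ^ (-t)‖ := by
    intro y h1 h2 t ht
    have hy0 : 0 < ‖y‖ := by linarith
    rcases lt_or_gt_of_ne ht with h | h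
    · have h3 : ‖y * q ^ (-t)‖ ≤ (1 + ‖q‖) / 2 := by
        rw [norm_mul, norm_zpow]
        have h5 : ‖q‖ ^ (-t) ≤ ‖q‖ ^ (1 : ℤ) :=
          zpow_le_zpow_right_of_le_one₀ hq' hq.le (by omega)
        calc ‖y‖ * ‖q‖ ^ (-t) ≤ M * ‖q‖ ^ (1 : ℤ) := by gcongr
          _ = (1 + ‖q‖) / 2 := by rw [hM, zpow_one]; field_simp
      have h4 := norm_sub_norm_le (1 : ℂ) (y * q ^ (-t))
      rw [norm_one] at h4
      rw [hδ]; linarith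
    · have h3 : (1 + ‖q‖) / 2 / ‖q‖ ≤ ‖y * q ^ (-t)‖ := by
        have h5 : ‖q‖ ^ (-1 : ℤ) ≤ ‖q‖ ^ (-t) :=
          zpow_le_zpow_right_of_le_one₀ hq' hq.le (by omega)
        rw [norm_mul, norm_zpow, div_eq_mul_inv, ← zpow_neg_one]
        gcongr
      have h4 := norm_sub_norm_le (y * q ^ (-t)) 1
      rw [norm_one, norm_sub_rev] at h4
      have h5 : 1 + δ ≤ (1 + ‖q‖) / 2 / ‖q‖ := by
        rw [le_div_iff₀ hq', hδ]; nlinarith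
      linarith
  have hu1 : (1 + ‖q‖) / 2 < ‖u‖ := by rw [hu]; linarith
  have hu2 : ‖u‖ < M := by rw [hu]; exact hM1
  refine tendsto_tsum_of_dominated_convergence
    ((summable_norm_thetaTerm hq0 hq one_ne_zero).mul_right (1 + (1 + M) / δ)) (fun t => ?_) ?_
  · refine Tendsto.const_mul _ ?_
    split_ifs with ht
    · exact tendsto_const_nhds
    · have h1 : 1 - u * q ^ (-t) ≠ 0 := norm_pos_iff.1 (hδ0.trans_le (hden u hu1 hu2 t ht))
      have : ContinuousAt (fun y : ℂ => (1 - y) / (1 - y * q ^ (-t))) u := by fun_prop (disch := exact h1)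
      exact this
  · have e1 := (continuous_norm.tendsto u).eventually (lt_mem_nhds hu1)
    have e2 := (continuous_norm.tendsto u).eventually (gt_mem_nhds hu2)
    filter_upwards [e1, e2] with y h1 h2 t
    rw [norm_mul]
    have hM0 : 0 ≤ (1 + M) / δ := by positivity
    gcongr
    split_ifs with ht
    · rw [norm_one]; linarith
    · rw [norm_div]
      have h3 : ‖1 - y‖ ≤ 1 + M := by
        refine (norm_sub_le _ _).trans ?_
        rw [norm_one]; linarith
      have := div_le_div₀ (by positivity) h3 hδ0 (hden y h1 h2 t ht)
      linarith

lemma continuous_qPochInf (hq : ‖q‖ < 1) : Continuous fun x => qPochInf x q := by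
  refine continuous_iff_continuousAt.2 fun x => ?_
  have h := tendsto_tprod_one_add_of_dominated_convergence (𝓕 := 𝓝 x)
    (f := fun x (i : ℕ) => -(q ^ i * x)) (g := fun i : ℕ => -(q ^ i * x))
    (bound := fun i => ‖q‖ ^ i * (‖x‖ + 1))
    ((summable_geometric_of_lt_one (norm_nonneg _) hq).mul_right _)
    (fun i => (by fun_prop : Continuous fun x : ℂ => -(q ^ i * x)).tendsto x) (by
      filter_upwards [(continuous_norm.tendsto x).eventually (gt_mem_nhds (lt_add_one ‖x‖))]
        with y hy i
      rw [norm_neg, norm_mul, norm_pow]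
      gcongr)
  simp only [← sub_eq_add_neg] at h
  exact h

/-- `j(y; q) / (1 - y)`, with its removable singularity at `y = 1` removed. -/
def regTheta (y q : ℂ) : ℂ := qPochInf (q * y) q * qPochInf (q / y) q * qPochInf q q

lemma j_eq_mul_regTheta (hq : ‖q‖ < 1) (y : ℂ) : j y q = (1 - y) * regTheta y q := by
  rw [j, qPochInf_eq_mul hq, regTheta]; ring

lemma continuousAt_regTheta (hq : ‖q‖ < 1) (hy : y ≠ 0) :
    ContinuousAt (fun y => regTheta y q) y := by
  have h1 : ContinuousAt (fun y => qPochInf (q * y) q) y :=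
    ((continuous_qPochInf hq).comp (continuous_const_mul q)).continuousAt
  have h2 : ContinuousAt (fun y => qPochInf (q / y) q) y :=
    ContinuousAt.comp (f := fun y => q / y) (g := fun x => qPochInf x q)
      (continuous_qPochInf hq).continuousAt (continuousAt_const.div continuousAt_id hy)
  exact (h1.mul h2).mul_const _

lemma regTheta_one (q : ℂ) : regTheta 1 q = qPochInf q q ^ 3 := by
  rw [regTheta, mul_one, div_one]; ring

lemma reg_mul_reg (hq : ‖q‖ < 1) (hy : y ≠ 1) :
    regPoleSeries y q * regTheta y q = poleSeries y q * j y q := by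
  rw [regPoleSeries_eq hy, j_eq_mul_regTheta hq]; ring

/-- Near every point `u` of the unit circle, `regPoleSeries * regTheta` is the limit of its
values at `(1 - 1/(n+1)) u`. -/
lemma tendsto_reg_mul_reg (hq0 : q ≠ 0) (hq : ‖q‖ < 1) {u : ℂ} (hu : ‖u‖ = 1) :
    Tendsto (fun n : ℕ => regPoleSeries ((1 - 1 / ((n : ℝ) + 1) : ℝ) * u) q *
      regTheta ((1 - 1 / ((n : ℝ) + 1) : ℝ) * u) q) atTop
      (𝓝 (regPoleSeries u q * regTheta u q)) := by
  have hu0 : u ≠ 0 := by rintro rfl; simp at hu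
  have h1 : Tendsto (fun n : ℕ => (((1 - 1 / ((n : ℝ) + 1) : ℝ) : ℂ)) * u) atTop (𝓝 u) := by
    have h := (Complex.continuous_ofReal.tendsto _).comp
      ((tendsto_one_div_add_atTop_nhds_zero_nat (𝕜 := ℝ)).const_sub 1)
    simpa using h.mul_const u
  exact ((continuousAt_regPoleSeries hq0 hq hu).tendsto.comp h1).mul
    ((continuousAt_regTheta hq hu0).tendsto.comp h1)

lemma eventually_lt_one_sub {ρ : ℝ} (hρ : ‖q‖ < ρ) :
    ∀ᶠ n : ℕ in atTop, ‖q‖ < ρ * (1 - 1 / ((n : ℝ) + 1)) ∧ 1 - 1 / ((n : ℝ) + 1) < 1 ∧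
      0 ≤ 1 - 1 / ((n : ℝ) + 1) := by
  have h1 : Tendsto (fun n : ℕ => ρ * (1 - 1 / ((n : ℝ) + 1))) atTop (𝓝 (ρ * (1 - 0))) :=
    ((tendsto_one_div_add_atTop_nhds_zero_nat (𝕜 := ℝ)).const_sub 1).const_mul ρ
  filter_upwards [h1.eventually (lt_mem_nhds (by simpa using hρ))] with n hn
  have h2 : (0 : ℝ) < 1 / ((n : ℝ) + 1) := by positivity
  have h3 : 1 / ((n : ℝ) + 1) ≤ 1 := by
    rw [div_le_one (by positivity)]
    have : (0 : ℝ) ≤ n := by positivity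
    linarith
  exact ⟨hn, by linarith, by linarith⟩

/-- The symmetry of the Lambert series makes `poleSeries(y) j(y)` independent of `y`; its value is
found by letting `y` tend to `1`. -/
lemma poleSeries_mul_j_of_norm_lt (hq0 : q ≠ 0) (hy : ‖q‖ < ‖y‖) (hy1 : ‖y‖ < 1) :
    poleSeries y q * j y q = qPochInf q q ^ 3 := by
  have hq : ‖q‖ < 1 := hy.trans hy1
  have hlim := tendsto_reg_mul_reg hq0 hq (u := 1) norm_one
  rw [regPoleSeries_one, regTheta_one, one_mul] at hlim
  refine tendsto_nhds_unique (tendsto_const_nhds.congr' ?_) hlim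
  filter_upwards [eventually_lt_one_sub hy] with n hn
  rw [mul_one]
  set w : ℂ := ((1 - 1 / ((n : ℝ) + 1) : ℝ) : ℂ) with hw
  have hwn : ‖w‖ = 1 - 1 / ((n : ℝ) + 1) := by
    rw [hw, Complex.norm_real, Real.norm_eq_abs, abs_of_nonneg hn.2.2]
  have hw1 : ‖w‖ < 1 := by rw [hwn]; exact hn.2.1
  have hyw : ‖q‖ < ‖y * w‖ := by rw [norm_mul, hwn]; exact hn.1
  have hw0 : ‖q‖ < ‖w‖ := by
    rw [norm_mul] at hyw
    exact hyw.trans_le (mul_le_of_le_one_left (norm_nonneg _) hy1.le)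
  have hyw1 : ‖y * w‖ < 1 := by
    rw [norm_mul]
    exact (mul_le_of_le_one_left (norm_nonneg _) hy1.le).trans_lt hw1
  have ne1 {x : ℂ} (hx : ‖x‖ < 1) : x ≠ 1 := by rintro rfl; simp at hx
  rw [reg_mul_reg hq (ne1 hw1)]
  have h1 := lambert_mul_j hq0 hw0 hw1 (ne_zero_of_norm_lt hy)
    (mul_zpow_ne_one hq0 hy hy1.le (ne1 hy1))
  have h2 := lambert_mul_j hq0 hy hy1 (ne_zero_of_norm_lt hw0)
    (mul_zpow_ne_one hq0 hw0 hw1.le (ne1 hw1))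
  rw [lambert_comm hq0 hy hy1 hw0 hw1, mul_comm w y] at h2
  have h3 := j_ne_zero hq hyw hyw1.le (ne1 hyw1)
  refine mul_right_cancel₀ h3 ?_
  linear_combination j w q * h2 - j y q * h1

lemma poleSeries_mul_j (hq0 : q ≠ 0) (hq : ‖q‖ < 1) (hy : ‖q‖ < ‖y‖) (hy1 : ‖y‖ ≤ 1)
    (hy2 : y ≠ 1) : poleSeries y q * j y q = qPochInf q q ^ 3 := by
  rcases hy1.lt_or_eq with h | h
  · exact poleSeries_mul_j_of_norm_lt hq0 hy h
  have hlim := tendsto_reg_mul_reg hq0 hq h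
  rw [reg_mul_reg hq hy2] at hlim
  refine tendsto_nhds_unique hlim (tendsto_const_nhds.congr' ?_)
  filter_upwards [eventually_lt_one_sub hy] with n hn
  set w : ℂ := ((1 - 1 / ((n : ℝ) + 1) : ℝ) : ℂ) * y with hw
  have hwn : ‖w‖ = ‖y‖ * (1 - 1 / ((n : ℝ) + 1)) := by
    rw [hw, norm_mul, Complex.norm_real, Real.norm_eq_abs, abs_of_nonneg hn.2.2, mul_comm]
  have hw1 : ‖w‖ < 1 := by rw [hwn, h, one_mul]; exact hn.2.1
  have hw2 : w ≠ 1 := by intro h; rw [h, norm_one] at hw1; exact lt_irrefl _ hw1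
  rw [reg_mul_reg hq hw2, poleSeries_mul_j_of_norm_lt hq0 (by rw [hwn]; exact hn.1) hw1]

/-- **Kronecker's formula** `∑_k w^k / (1 - y q^k) = (q; q)_∞³ j(yw; q) / (j(y; q) j(w; q))`. -/
theorem lambert_eq (hq0 : q ≠ 0) (hw : ‖q‖ < ‖w‖) (hw1 : ‖w‖ < 1)
    (hy : ‖q‖ < ‖y‖) (hy1 : ‖y‖ ≤ 1) (hy2 : y ≠ 1) :
    lambert y w q = qPochInf q q ^ 3 * j (y * w) q / (j y q * j w q) := by
  have hq : ‖q‖ < 1 := hw.trans hw1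
  have hw2 : w ≠ 1 := by rintro rfl; simp at hw1
  have h1 := j_ne_zero hq hy hy1 hy2
  have h2 := j_ne_zero hq hw hw1.le hw2
  rw [eq_div_iff (mul_ne_zero h1 h2), ← poleSeries_mul_j hq0 hq hy hy1 hy2]
  linear_combination j y q * lambert_mul_j hq0 hw hw1 (ne_zero_of_norm_lt hy)
    (mul_zpow_ne_one hq0 hy hy1 hy2)

end Kronecker

/-! ### Splitting an Appell function -/

section Appell

variable {q x z : ℂ}

lemma thetaTerm_one_add (hq0 : q ≠ 0) (a b : ℤ) :
    thetaTerm 1 q (a + b) = thetaTerm 1 q a * thetaTerm 1 q b * q ^ (a * b) := by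
  have h : (a + b) * (a + b - 1) / 2 = a * (a - 1) / 2 + b * (b - 1) / 2 + a * b := by
    linarith [two_mul_tri a, two_mul_tri b, two_mul_tri (a + b)]
  rw [thetaTerm, thetaTerm, thetaTerm, h, zpow_add₀ hq0, zpow_add₀ hq0, zpow_add₀ (by norm_num)]
  simp only [one_zpow]
  ring

lemma thetaTerm_one_mul_succ (hq0 : q ≠ 0) (r : ℤ) :
    thetaTerm 1 q r * thetaTerm 1 q (r + 1) = -q ^ (r * r) := by
  have h : r * r = r * (r - 1) / 2 + (r * (r - 1) / 2 + r) := by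
    linarith [two_mul_tri r]
  have h1 : ((-1 : ℂ) ^ r) * (-1) ^ r = 1 := by rw [← mul_zpow]; simp
  rw [thetaTerm_add_one hq0 one_ne_zero, h, zpow_add₀ hq0, zpow_add₀ hq0, thetaTerm]
  simp only [one_zpow]
  linear_combination -(q ^ (r * (r - 1) / 2) * q ^ (r * (r - 1) / 2) * q ^ r) * h1

lemma m_eq (x z q : ℂ) :
    m x z q = 1 / j z q * ∑' r : ℤ, thetaTerm z q r / (1 - q ^ (r - 1) * x * z) := rfl

lemma hasSum_m (hq0 : q ≠ 0) (hq : ‖q‖ < 1) (hx : x ≠ 0) (hz : z ≠ 0) (hj : j z q ≠ 0) :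
    HasSum (fun r : ℤ => thetaTerm z q r / (1 - q ^ (r - 1) * x * z)) (j z q * m x z q) := by
  obtain ⟨C, hC⟩ := exists_norm_inv_one_sub_le hq0 hq
    (mul_ne_zero (mul_ne_zero (inv_ne_zero hq0) hx) hz)
  have h : Summable fun r : ℤ => thetaTerm z q r / (1 - q ^ (r - 1) * x * z) := by
    refine Summable.of_norm_bounded ((summable_norm_thetaTerm hq0 hq hz).mul_right C) fun r => ?_
    have e : q ^ (r - 1) * x * z = q⁻¹ * x * z * q ^ r := by rw [zpow_sub_one₀ hq0]; ring
    rw [div_eq_mul_inv, norm_mul, e]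
    gcongr
    exact (hC r).1
  rw [m_eq, ← mul_assoc, mul_one_div_cancel hj, one_mul]
  exact h.hasSum

/-- The functional equation `m(qx, z; q) = 1 - x m(x, z; q)`. -/
lemma m_mul_left (hq0 : q ≠ 0) (hq : ‖q‖ < 1) (hx : x ≠ 0) (hz : z ≠ 0) (hj : j z q ≠ 0)
    (hne : ∀ r : ℤ, q ^ r * x * z ≠ 1) : m (q * x) z q = 1 - x * m x z q := by
  have h1 := ((hasSum_m hq0 hq (mul_ne_zero hq0 hx) hz hj).int_shift (-1)).mul_left z
  have h2 := (hasSum_m hq0 hq hx hz hj).mul_left (x * z)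
  have h3 := ((hasSum_thetaTerm hq0 hq hz).int_shift (-1)).mul_left z
  have h4 := (h1.add h2).unique (h3.of_eq (fun r => ?_) rfl)
  · refine mul_left_cancel₀ (mul_ne_zero hz hj) ?_
    linear_combination h4
  · have e1 := thetaTerm_sub_one hq0 hz r
    have e2 : q ^ (r + -1 - 1) * (q * x) * z = q ^ (r - 1) * x * z := by
      rw [show r - 1 = (r + -1 - 1) + 1 by ring, zpow_add_one₀ hq0]
      ring
    have e3 : 1 - q ^ (r - 1) * x * z ≠ 0 := sub_ne_zero.2 (hne _).symm
    have e4 : q ^ (1 - r) * q ^ (r - 1) = 1 := by rw [← zpow_add₀ hq0]; simp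
    rw [e2, ← mul_div_assoc, ← sub_eq_add_neg r 1, e1]
    rw [← mul_div_assoc, ← add_div, div_eq_iff e3]
    linear_combination -thetaTerm z q r * x * z * e4

/-- The coefficients, relative to those of the theta series, of the Laurent series in `|q| < |z| < 1`
of `j(z; q) m(1, z; q)`. -/
def appellCoeff (q : ℂ) (N : ℤ) : ℂ := -∑' k : ℤ, hypSign (N - 1 - k) k * (thetaTerm 1 q (k + 1))⁻¹

lemma appellCoeff_zero (q : ℂ) : appellCoeff q 0 = 0 := by
  rw [appellCoeff, neg_eq_zero]
  refine (tsum_congr fun k => ?_).trans tsum_zero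
  rw [hypSign, if_neg (by omega), if_neg (by omega), zero_mul]

lemma appellCoeff_add_one (q : ℂ) (N : ℤ) :
    appellCoeff q (N + 1) = appellCoeff q N - (thetaTerm 1 q (N + 1))⁻¹ := by
  have hs (M : ℤ) : Summable fun k : ℤ => hypSign (M - 1 - k) k * (thetaTerm 1 q (k + 1))⁻¹ := by
    refine summable_of_ne_finset_zero (s := Finset.Icc (-|M|) |M|) fun k hk => ?_
    rw [Finset.mem_Icc] at hk
    have h1 := le_abs_self M
    have h2 := neg_abs_le M
    rw [hypSign, if_neg (by omega), if_neg (by omega), zero_mul]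
  have h1 := (hs (N + 1)).tsum_sub (hs N)
  rw [tsum_eq_single N] at h1
  · have h2 : hypSign (N + 1 - 1 - N) N - hypSign (N - 1 - N) N = 1 := by
      rcases lt_or_ge N 0 with h | h
      · rw [hypSign, if_neg (by omega), if_neg (by omega), hypSign, if_neg (by omega),
          if_pos (by omega)]
        norm_num
      · rw [hypSign, if_pos (by omega), hypSign, if_neg (by omega), if_neg (by omega)]
        norm_num
    rw [← sub_mul, h2, one_mul] at h1
    rw [appellCoeff, appellCoeff]
    linear_combination h1
  · intro k hk
    rw [← sub_mul]
    have h2 : hypSign (N + 1 - 1 - k) k = hypSign (N - 1 - k) k := by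
      rw [hypSign, hypSign]
      congr 1
      · simp only [eq_iff_iff]; omega
      · congr 1
        simp only [eq_iff_iff]; omega
    rw [h2, sub_self, zero_mul]

lemma norm_thetaTerm_one_le (hq : ‖q‖ < 1) (k : ℤ) : ‖thetaTerm 1 q k‖ ≤ 1 := by
  have h : 0 ≤ k * (k - 1) / 2 := by
    have h1 : 0 ≤ k * (k - 1) := by
      rcases lt_or_ge k 1 with h | h <;> nlinarith
    omega
  rw [thetaTerm, one_zpow, mul_one, norm_mul, norm_zpow, norm_neg, norm_one, one_zpow, one_mul,
    norm_zpow]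
  lift k * (k - 1) / 2 to ℕ using h with a
  rw [zpow_natCast]
  exact pow_le_one₀ (norm_nonneg _) hq.le

/-- The Laurent expansion of `j(z; q) m(1, z; q)` in `|q| < |z| < 1`. -/
lemma hasSum_appellCoeff (hq0 : q ≠ 0) (hz : ‖q‖ < ‖z‖) (hz1 : ‖z‖ < 1) :
    HasSum (fun N : ℤ => thetaTerm z q N * appellCoeff q N) (j z q * m 1 z q) := by
  have hq : ‖q‖ < 1 := hz.trans hz1
  have hq' : 0 < ‖q‖ := norm_pos_iff.2 hq0
  have hz0 : z ≠ 0 := ne_zero_of_norm_lt hz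
  have hz2 : z ≠ 1 := by rintro rfl; simp at hz1
  have hj := j_ne_zero hq hz hz1.le hz2
  have hm := (hasSum_m hq0 hq one_ne_zero hz0 hj).int_shift 1
  set F : ℤ × ℤ → ℂ := fun p =>
    thetaTerm 1 q (p.1 + 1) * z * (hypSign p.1 p.2 * (z ^ p.1 * z ^ p.2 * q ^ (p.1 * p.2))) with hF
  have hs : Summable F := by
    refine Summable.of_norm_bounded ((summable_norm_hyp hq0 hz hz1 hz hz1).mul_left (1 * ‖z‖))
      fun p => ?_
    rw [hF]
    simp only [norm_mul (_ * z), norm_mul _ z]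
    gcongr
    exact norm_thetaTerm_one_le hq _
  have hfib (l : ℤ) : HasSum (fun k => F (l, k)) (thetaTerm z q (l + 1) / (1 - z * q ^ l)) := by
    have h := (hasSum_hypSign_mul_zpow (k := l) (u := z * q ^ l) (fun hk => ?_)
      (fun hk => ?_)).mul_left (thetaTerm z q (l + 1))
    · refine h.of_eq (fun k => ?_) (by rw [mul_one_div])
      rw [hF, mul_zpow, ← zpow_mul, thetaTerm_eq_one_mul z, zpow_add_one₀ hz0]
      ring
    · rw [norm_mul, norm_zpow]
      exact (mul_le_of_le_one_right (norm_nonneg _) (zpow_le_one₀ hq' hq.le hk)).trans_lt hz1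
    · rw [norm_mul, norm_zpow]
      have h1 : ‖q‖ ^ (-1 : ℤ) ≤ ‖q‖ ^ l := zpow_le_zpow_right_of_le_one₀ hq' hq.le (by omega)
      rw [zpow_neg_one] at h1
      calc 1 = ‖q‖ * ‖q‖⁻¹ := (mul_inv_cancel₀ hq'.ne').symm
        _ < ‖z‖ * ‖q‖⁻¹ := by gcongr
        _ ≤ ‖z‖ * ‖q‖ ^ l := by gcongr
  have hsum : HasSum F (j z q * m 1 z q) := by
    have h := (hs.hasSum.prod_fiberwise hfib).unique (hm.of_eq (fun l => ?_) rfl)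
    · rw [← h]; exact hs.hasSum
    · rw [add_sub_cancel_right, mul_one, mul_comm z]
  let e : ℤ × ℤ ≃ ℤ × ℤ :=
    { toFun := fun p => (p.1 - 1 - p.2, p.2)
      invFun := fun p => (p.1 + 1 + p.2, p.2)
      left_inv := fun p => Prod.ext (by simp only []; ring) rfl
      right_inv := fun p => Prod.ext (by simp only []; ring) rfl }
  have h2 : HasSum (fun p : ℤ × ℤ => F (p.1 - 1 - p.2, p.2)) (j z q * m 1 z q) :=
    e.hasSum_iff.2 hsum
  refine (h2.prod_fiberwise fun N => (h2.summable.prod_factor N).hasSum).of_eq (fun N => ?_) rfl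
  rw [appellCoeff, ← tsum_neg, ← tsum_mul_left]
  refine tsum_congr fun k => ?_
  have e1 := thetaTerm_one_add hq0 (N - 1 - k) (k + 1)
  rw [show N - 1 - k + (k + 1) = N by ring] at e1
  have e2 := thetaTerm_add_one hq0 one_ne_zero (N - 1 - k)
  have e3 := thetaTerm_ne_zero hq0 one_ne_zero (k + 1)
  have e4 : z ^ N = z ^ (N - 1 - k) * z ^ k * z := by
    rw [← zpow_add₀ hz0, ← zpow_add_one₀ hz0]; ring_nf
  have e5 : q ^ ((N - 1 - k) * (k + 1)) = q ^ ((N - 1 - k) * k) * q ^ (N - 1 - k) := by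
    rw [← zpow_add₀ hq0]; ring_nf
  rw [hF, thetaTerm_eq_one_mul z q N]
  simp only []
  rw [e2, e1, e4, e5]
  field_simp

/-- The coefficients `B(N) = ∑_{r<n} (-1)^r q^{-r(r+1)/2 + rN} m(q^{n(h-r+N)}, Z; q^{n²})`,
where `n = 2h + 1`; here `(-1)^r q^{-r(r+1)/2}` is written as `-1 / thetaTerm 1 q (r + 1)`. -/
def splitCoeff (h : ℕ) (Z q : ℂ) (N : ℤ) : ℂ :=
  ∑ r ∈ Finset.range (2 * h + 1), -(q ^ (r * N) * (thetaTerm 1 q (r + 1))⁻¹ *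
    m (q ^ ((2 * h + 1 : ℤ) * (h - r + N))) Z (q ^ (2 * h + 1) ^ 2))

lemma splitCoeff_add_one {h : ℕ} {Z : ℂ} (hq0 : q ≠ 0) (hq : ‖q‖ < 1) (hZ : Z ≠ 0)
    (hj : j Z (q ^ (2 * h + 1) ^ 2) ≠ 0) (hne : ∀ k : ℤ, Z * (q ^ (2 * h + 1)) ^ k ≠ 1) (N : ℤ) :
    splitCoeff h Z q (N + 1) = 1 - q ^ N * splitCoeff h Z q N := by
  rw [splitCoeff, splitCoeff, Finset.sum_range_succ', Finset.sum_range_succ, mul_add (q ^ N),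
    Finset.mul_sum]
  have h1 : ∀ r ∈ Finset.range (2 * h),
      -(q ^ (((r + 1 : ℕ) : ℤ) * (N + 1)) * (thetaTerm 1 q (((r + 1 : ℕ) : ℤ) + 1))⁻¹ *
        m (q ^ ((2 * h + 1 : ℤ) * (h - ((r + 1 : ℕ) : ℤ) + (N + 1)))) Z (q ^ (2 * h + 1) ^ 2)) =
      -(q ^ N * -(q ^ (r * N) * (thetaTerm 1 q (r + 1))⁻¹ *
        m (q ^ ((2 * h + 1 : ℤ) * (h - r + N))) Z (q ^ (2 * h + 1) ^ 2))) := by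
    intro r _
    push_cast
    rw [show (h : ℤ) - (r + 1) + (N + 1) = h - r + N by ring, thetaTerm_add_one hq0 one_ne_zero,
      show ((r : ℤ) + 1) * (N + 1) = r * N + N + (r + 1) by ring, zpow_add₀ hq0 _ ((r : ℤ) + 1),
      zpow_add₀ hq0]
    have e1 := thetaTerm_ne_zero hq0 one_ne_zero ((r : ℤ) + 1)
    have e2 := zpow_ne_zero ((r : ℤ) + 1) hq0
    field_simp
  rw [Finset.sum_congr rfl h1, Finset.sum_neg_distrib]
  -- the two boundary terms are related by the functional equation of `m`
  have hQ : q ^ (2 * h + 1) ^ 2 ≠ 0 := pow_ne_zero _ hq0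
  have hQ1 : ‖q ^ (2 * h + 1) ^ 2‖ < 1 := by
    rw [norm_pow]; exact pow_lt_one₀ (norm_nonneg _) hq (by positivity)
  have h2 := m_mul_left (x := q ^ ((2 * h + 1 : ℤ) * (N - h))) hQ hQ1 (zpow_ne_zero _ hq0) hZ hj
    (fun r => by
      have e1 : (q ^ (2 * h + 1) ^ 2) ^ r * q ^ ((2 * h + 1 : ℤ) * (N - h)) * Z =
          Z * (q ^ (2 * h + 1)) ^ ((2 * h + 1 : ℤ) * r + (N - h)) := by
        rw [← zpow_natCast, ← zpow_natCast, ← zpow_mul, ← zpow_mul, ← zpow_add₀ hq0, mul_comm]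
        congr 2
        push_cast
        ring
      rw [e1]
      exact hne _)
  have e1 : q ^ (2 * h + 1) ^ 2 * q ^ ((2 * h + 1 : ℤ) * (N - h)) =
      q ^ ((2 * h + 1 : ℤ) * (h - ((0 : ℕ) : ℤ) + (N + 1))) := by
    rw [← zpow_natCast, ← zpow_add₀ hq0]
    congr 1
    push_cast
    ring
  have e2 : (h : ℤ) - ((2 * h : ℕ) : ℤ) + N = N - h := by push_cast; ring
  have e3 : thetaTerm 1 q (((2 * h : ℕ) : ℤ) + 1) = -q ^ ((2 * h + 1 : ℤ) * h) := by
    have e4 : (((2 * h : ℕ) : ℤ) + 1) * (((2 * h : ℕ) : ℤ) + 1 - 1) / 2 = (2 * h + 1 : ℤ) * h := by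
      have := two_mul_tri (((2 * h : ℕ) : ℤ) + 1)
      push_cast at this ⊢
      linarith
    rw [thetaTerm, e4, one_zpow, mul_one, zpow_add_one₀ (by norm_num), zpow_natCast, pow_mul]
    norm_num
  have e5 : thetaTerm 1 q (((0 : ℕ) : ℤ) + 1) = -1 := by simp [thetaTerm]
  rw [← e1, h2, e2, e3, e5]
  have e6 : q ^ ((2 * h + 1 : ℤ) * (N - h)) =
      q ^ N * q ^ (((2 * h : ℕ) : ℤ) * N) * (q ^ ((2 * h + 1 : ℤ) * h))⁻¹ := by
    rw [← zpow_neg, ← zpow_add₀ hq0, ← zpow_add₀ hq0]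
    congr 1
    push_cast
    ring
  rw [e6]
  have e7 := zpow_ne_zero ((2 * h + 1 : ℤ) * h) hq0
  simp only [Nat.cast_zero, zero_mul, zpow_zero]
  field_simp
  ring

/-- Laurent expansion in `z` of one term of the theta part of the splitting formula, obtained by
multiplying a Lambert series by a theta series. -/
lemma hasSum_splitTerm {h r : ℕ} {Z : ℂ} (hr : r < 2 * h + 1) (hq0 : q ≠ 0) (hz : ‖q‖ < ‖z‖)
    (hz1 : ‖z‖ < 1) (hZ : Z ≠ 0) (hj : j Z (q ^ (2 * h + 1) ^ 2) ≠ 0) :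
    HasSum (fun N : ℤ => -(j Z (q ^ (2 * h + 1) ^ 2) / Z) *
        -(q ^ (r * N) * (thetaTerm 1 q (r + 1))⁻¹ *
          m (q ^ ((2 * h + 1 : ℤ) * (h - r + N))) Z (q ^ (2 * h + 1) ^ 2)) * z ^ N)
      (thetaTerm z q r * (q ^ r * z) ^ (-(h : ℤ)) * (lambert Z (q ^ r * z) (q ^ (2 * h + 1)) *
        j ((q ^ r * z) ^ (2 * h + 1) / Z) (q ^ (2 * h + 1) ^ 2))) := by
  have hq : ‖q‖ < 1 := hz.trans hz1
  have hq' : 0 < ‖q‖ := norm_pos_iff.2 hq0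
  have hz0 : z ≠ 0 := ne_zero_of_norm_lt hz
  have hw0 : q ^ r * z ≠ 0 := mul_ne_zero (pow_ne_zero _ hq0) hz0
  have hQ : q ^ (2 * h + 1) ^ 2 ≠ 0 := pow_ne_zero _ hq0
  have hQ1 : ‖q ^ (2 * h + 1) ^ 2‖ < 1 := by
    rw [norm_pow]; exact pow_lt_one₀ (norm_nonneg _) hq (by positivity)
  have hw : ‖q ^ (2 * h + 1)‖ < ‖q ^ r * z‖ := by
    rw [norm_pow, norm_mul, norm_pow]
    calc ‖q‖ ^ (2 * h + 1) ≤ ‖q‖ ^ (r + 1) := pow_le_pow_of_le_one hq'.le hq.le hr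
      _ = ‖q‖ ^ r * ‖q‖ := pow_succ _ _
      _ < ‖q‖ ^ r * ‖z‖ := by gcongr
  have hw1 : ‖q ^ r * z‖ < 1 := by
    rw [norm_mul, norm_pow]
    exact (mul_le_of_le_one_left (norm_nonneg _) (pow_le_one₀ hq'.le hq.le)).trans_lt hz1
  have hv0 : (q ^ r * z) ^ (2 * h + 1) / Z ≠ 0 := div_ne_zero (pow_ne_zero _ hw0) hZ
  have h1 := (hasSum_cauchyProduct (hasSum_lambert (pow_ne_zero _ hq0) hw hw1 hZ)
    (hasSum_thetaTerm hQ hQ1 hv0) (summable_norm_lambert (pow_ne_zero _ hq0) hw hw1 hZ)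
    (summable_norm_thetaTerm hQ hQ1 hv0) (h - r) (2 * h + 1)).mul_left
    (thetaTerm z q r * (q ^ r * z) ^ (-(h : ℤ)))
  refine h1.of_eq (fun N => ?_) rfl
  have h2 := (Equiv.subLeft (1 : ℤ)).hasSum_iff.2
    (hasSum_m hQ hQ1 (x := q ^ ((2 * h + 1 : ℤ) * (h - r + N))) (zpow_ne_zero _ hq0) hZ hj)
  rw [show -(j Z (q ^ (2 * h + 1) ^ 2) / Z) *
        -(q ^ (r * N) * (thetaTerm 1 q (r + 1))⁻¹ *
          m (q ^ ((2 * h + 1 : ℤ) * (h - r + N))) Z (q ^ (2 * h + 1) ^ 2)) * z ^ N =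
      q ^ (r * N) * (thetaTerm 1 q (r + 1))⁻¹ * z ^ N / Z * (j Z (q ^ (2 * h + 1) ^ 2) *
        m (q ^ ((2 * h + 1 : ℤ) * (h - r + N))) Z (q ^ (2 * h + 1) ^ 2)) by ring]
  rw [← h2.tsum_eq, ← tsum_mul_left, ← tsum_mul_left]
  refine tsum_congr fun t => ?_
  simp only [Function.comp, Equiv.subLeft_apply]
  rw [thetaTerm_one_sub hZ, div_eq_mul_inv ((q ^ r * z) ^ (2 * h + 1)) Z,
    mul_comm ((q ^ r * z) ^ (2 * h + 1)) Z⁻¹, thetaTerm_mul, thetaTerm_eq_one_mul z q r]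
  have e1 : (q ^ (2 * h + 1) ^ 2) ^ (1 - t - 1) * q ^ ((2 * h + 1 : ℤ) * (h - r + N)) * Z =
      Z * (q ^ (2 * h + 1)) ^ (N + (h - r) - (2 * h + 1) * t) := by
    rw [← zpow_natCast, ← zpow_natCast, ← zpow_mul, ← zpow_mul, ← zpow_add₀ hq0, mul_comm]
    congr 2
    push_cast
    ring
  have e2 : (q ^ r * z) ^ (N + (h - r) - (2 * h + 1) * t) =
      (q ^ r * z) ^ N * (q ^ r * z) ^ (h : ℤ) / ((q ^ r * z) ^ (r : ℤ) *
        ((q ^ r * z) ^ (2 * h + 1)) ^ t) := by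
    rw [zpow_sub₀ hw0, zpow_add₀ hw0, zpow_sub₀ hw0, zpow_mul, ← zpow_natCast _ (2 * h + 1)]
    push_cast
    rw [mul_div_assoc', div_div]
  have e3 := thetaTerm_one_mul_succ hq0 r
  have e4 : (q ^ r * z) ^ N = q ^ (r * N) * z ^ N := by
    rw [mul_zpow, ← zpow_natCast q r, ← zpow_mul]
  have e5 : (q ^ r * z) ^ (r : ℤ) = q ^ ((r : ℤ) * r) * z ^ (r : ℤ) := by
    rw [mul_zpow, ← zpow_natCast q r, ← zpow_mul]
  have e6 := thetaTerm_ne_zero hq0 one_ne_zero ((r : ℤ) + 1)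
  have e7 : thetaTerm 1 q r = -q ^ ((r : ℤ) * r) * (thetaTerm 1 q (r + 1))⁻¹ := by
    rw [← e3]; field_simp
  rw [e1, e2, e4, e5, e7, zpow_neg]
  have e8 := zpow_ne_zero ((r : ℤ) * r) hq0
  have e9 := zpow_ne_zero (r : ℤ) hz0
  have e10 := zpow_ne_zero (h : ℤ) hw0
  have e11 := zpow_ne_zero t (pow_ne_zero (2 * h + 1) hw0)
  field_simp

/-- The splitting of `m(1, z; q)` into `n = 2h + 1` Appell functions with base `q^{n²}` and a sum of
theta functions. Both sides are compared through their Laurent coefficients in `|q| < |z| < 1`. -/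
theorem m_one_split {h : ℕ} {Z : ℂ} (hq0 : q ≠ 0) (hz : ‖q‖ < ‖z‖) (hz1 : ‖z‖ < 1) (hZ : Z ≠ 0)
    (hj : j Z (q ^ (2 * h + 1) ^ 2) ≠ 0) (hne : ∀ k : ℤ, Z * (q ^ (2 * h + 1)) ^ k ≠ 1) :
    m 1 z q = splitCoeff h Z q 0 + Z / (j Z (q ^ (2 * h + 1) ^ 2) * j z q) *
      ∑ r ∈ Finset.range (2 * h + 1), thetaTerm z q r * (q ^ r * z) ^ (-(h : ℤ)) *
        (lambert Z (q ^ r * z) (q ^ (2 * h + 1)) *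
          j ((q ^ r * z) ^ (2 * h + 1) / Z) (q ^ (2 * h + 1) ^ 2)) := by
  have hq : ‖q‖ < 1 := hz.trans hz1
  have hz0 : z ≠ 0 := ne_zero_of_norm_lt hz
  have hz2 : z ≠ 1 := by rintro rfl; simp at hz1
  have hjz := j_ne_zero hq hz hz1.le hz2
  have h1 := hasSum_sum fun r hr => hasSum_splitTerm (Finset.mem_range.1 hr) hq0 hz hz1 hZ hj
  have h2 := ((hasSum_thetaTerm hq0 hq hz0).mul_right (splitCoeff h Z q 0)).add
    (h1.mul_left (Z / j Z (q ^ (2 * h + 1) ^ 2)))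
  -- the coefficients agree because they satisfy the same first order recurrence
  have hv : ∀ N : ℤ, splitCoeff h Z q N +
      thetaTerm 1 q N * (appellCoeff q N - splitCoeff h Z q 0) = 0 := by
    intro N
    rw [eq_thetaTerm_mul hq0 one_ne_zero (u := fun N => splitCoeff h Z q N +
      thetaTerm 1 q N * (appellCoeff q N - splitCoeff h Z q 0)) (fun N => ?_) N]
    · simp [thetaTerm_zero, appellCoeff_zero]
    · have e1 := thetaTerm_ne_zero hq0 one_ne_zero N
      have e2 := zpow_ne_zero N hq0
      rw [splitCoeff_add_one hq0 hq hZ hj hne, appellCoeff_add_one,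
        thetaTerm_add_one hq0 one_ne_zero]
      field_simp
      ring
  have h3 := (hasSum_appellCoeff hq0 hz hz1).unique (h2.of_eq (fun N => ?_) rfl)
  · rw [← mul_right_inj' hjz, h3, mul_add, ← mul_assoc]
    congr 2
    field_simp
  · have e1 := hv N
    rw [← Finset.sum_mul, ← Finset.mul_sum, ← splitCoeff, thetaTerm_eq_one_mul z]
    have e2 : Z / j Z (q ^ (2 * h + 1) ^ 2) *
        (-(j Z (q ^ (2 * h + 1) ^ 2) / Z) * splitCoeff h Z q N * z ^ N) =
        -(splitCoeff h Z q N * z ^ N) := by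
      field_simp
    rw [e2]
    linear_combination z ^ N * e1

end Appell

/-! ### A Lerch-type series for `V₀` -/

section Transformation

variable {q x z : ℂ}

lemma summable_pow_sq_mul {ρ : ℝ} (h0 : 0 ≤ ρ) (h1 : ρ < 1) {K : ℝ} (hK : 0 ≤ K) :
    Summable fun n : ℕ => ρ ^ n ^ 2 * K ^ n := by
  have hlim : Tendsto (fun n : ℕ => ρ ^ n * K) atTop (𝓝 0) := by
    simpa using (tendsto_pow_atTop_nhds_zero_of_lt_one h0 h1).mul_const K
  refine Summable.of_norm_bounded_eventually_nat
    (summable_geometric_of_lt_one (r := (1 / 2 : ℝ)) (by norm_num) (by norm_num)) ?_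
  filter_upwards [hlim.eventually (gt_mem_nhds (show (0 : ℝ) < 1 / 2 by norm_num))] with n hn
  rw [Real.norm_of_nonneg (by positivity), sq, pow_mul, ← mul_pow]
  exact pow_le_pow_left₀ (by positivity) hn.le n

/-- A bounded solution of `D n = K n * D (n + 1)` with `K → 0` vanishes: far out, `D n` is at most
`2^{-k}` times the bound for every `k`. -/
lemma eq_zero_of_eq_mul_succ {D K : ℕ → ℂ} {M : ℝ} (hD : ∀ n, D n = K n * D (n + 1))
    (hM : ∀ n, ‖D n‖ ≤ M) (hK : Tendsto K atTop (𝓝 0)) : D 0 = 0 := by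
  have hM0 : 0 ≤ M := (norm_nonneg _).trans (hM 0)
  obtain ⟨N, hN⟩ := eventually_atTop.1
    (hK.norm.eventually (gt_mem_nhds (show ‖(0 : ℂ)‖ < 1 / 2 by norm_num)))
  have h1 : ∀ k n, N ≤ n → ‖D n‖ ≤ (1 / 2) ^ k * M := by
    intro k
    induction k with
    | zero => intro n _; simpa using hM n
    | succ k ih =>
      intro n hn
      rw [hD n, norm_mul, pow_succ', mul_assoc]
      exact mul_le_mul (hN n hn).le (ih _ (by omega)) (norm_nonneg _) (by norm_num)
  have h2 : D N = 0 := by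
    have h3 : Tendsto (fun k : ℕ => (1 / 2 : ℝ) ^ k * M) atTop (𝓝 0) := by
      simpa using (tendsto_pow_atTop_nhds_zero_of_lt_one (r := (1 / 2 : ℝ)) (by norm_num)
        (by norm_num)).mul_const M
    exact norm_le_zero_iff.1 (ge_of_tendsto' h3 fun k => h1 k N le_rfl)
  have h3 : ∀ k ≤ N, D (N - k) = 0 := by
    intro k
    induction k with
    | zero => intro _; exact h2
    | succ k ih =>
      intro hk
      rw [hD, show N - (k + 1) + 1 = N - k by omega, ih (by omega), mul_zero]
  simpa using h3 N le_rfl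

/-- The terms of `F(x) = ∑ x^n q^{n²} (-xq; q²)_n / (xq; q²)_n`, which at `x = 1` is the series
in the definition of `V₀`. -/
def fTerm (q x : ℂ) (n : ℕ) : ℂ :=
  x ^ n * q ^ n ^ 2 * qPoch (-(x * q)) (q ^ 2) n / qPoch (x * q) (q ^ 2) n

/-- The terms of `G(x) = ∑ x^{2n} q^{2n²} (-q²; q⁴)_n / (xq; q²)_{2n+1}`. -/
def gTerm (q x : ℂ) (n : ℕ) : ℂ :=
  x ^ (2 * n) * q ^ (2 * n ^ 2) * qPoch (-q ^ 2) (q ^ 4) n / qPoch (x * q) (q ^ 2) (2 * n + 1)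

/-- Both `F` and `G` solve `F(x) = 1 + fgFactor(x) F(q² x)`. -/
def fgFactor (q x : ℂ) : ℂ := x * q * (1 + x * q) / (1 - x * q)

lemma norm_mul_le_of_norm_le_one (hx : ‖x‖ ≤ 1) : ‖x * q‖ ≤ ‖q‖ := by
  rw [norm_mul]; exact mul_le_of_le_one_left (norm_nonneg _) hx

lemma norm_sq_le_one (hq : ‖q‖ < 1) : ‖q ^ 2‖ ≤ 1 := by
  rw [norm_pow]; exact pow_le_one₀ (norm_nonneg _) hq.le

lemma norm_fTerm_le (hq : ‖q‖ < 1) (hx : ‖x‖ ≤ 1) (n : ℕ) :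
    ‖fTerm q x n‖ ≤ ‖q‖ ^ n ^ 2 * (2 * (1 - ‖q‖)⁻¹) ^ n := by
  have hxq := norm_mul_le_of_norm_le_one (q := q) hx
  rw [fTerm, div_eq_mul_inv, norm_mul, norm_mul, norm_mul, norm_pow, norm_pow, mul_pow]
  have h1 := norm_qPoch_le (norm_sq_le_one hq) (x := -(x * q))
    (by rw [norm_neg]; exact hxq.trans hq.le) n
  have h2 := norm_qPoch_inv_le (norm_sq_le_one hq) hxq hq n
  have h3 : ‖x‖ ^ n ≤ 1 := pow_le_one₀ (norm_nonneg _) hx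
  calc ‖x‖ ^ n * ‖q‖ ^ n ^ 2 * ‖qPoch (-(x * q)) (q ^ 2) n‖ * ‖(qPoch (x * q) (q ^ 2) n)⁻¹‖
      ≤ 1 * ‖q‖ ^ n ^ 2 * 2 ^ n * (1 - ‖q‖)⁻¹ ^ n := by gcongr
    _ = _ := by ring

lemma norm_gTerm_le (hq : ‖q‖ < 1) (hx : ‖x‖ ≤ 1) (n : ℕ) :
    ‖gTerm q x n‖ ≤ (1 - ‖q‖)⁻¹ * (‖q‖ ^ n ^ 2 * (2 * (1 - ‖q‖)⁻¹ ^ 2) ^ n) := by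
  have hxq := norm_mul_le_of_norm_le_one (q := q) hx
  have hq4 : ‖q ^ 4‖ ≤ 1 := by rw [norm_pow]; exact pow_le_one₀ (norm_nonneg _) hq.le
  rw [gTerm, div_eq_mul_inv, norm_mul, norm_mul, norm_mul, norm_pow, norm_pow]
  have h1 := norm_qPoch_le hq4 (x := -q ^ 2) (by rw [norm_neg]; exact norm_sq_le_one hq) n
  have h2 := norm_qPoch_inv_le (norm_sq_le_one hq) hxq hq (2 * n + 1)
  have h3 : ‖x‖ ^ (2 * n) ≤ 1 := pow_le_one₀ (norm_nonneg _) hx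
  have h4 : ‖q‖ ^ (2 * n ^ 2) ≤ ‖q‖ ^ n ^ 2 :=
    pow_le_pow_of_le_one (norm_nonneg _) hq.le (by omega)
  calc _ ≤ 1 * ‖q‖ ^ n ^ 2 * 2 ^ n * (1 - ‖q‖)⁻¹ ^ (2 * n + 1) := by gcongr
    _ = _ := by rw [mul_pow, ← pow_mul]; ring

lemma summable_fBound (hq : ‖q‖ < 1) :
    Summable fun n : ℕ => ‖q‖ ^ n ^ 2 * (2 * (1 - ‖q‖)⁻¹) ^ n :=
  summable_pow_sq_mul (norm_nonneg _) hq
    (mul_nonneg zero_le_two (inv_nonneg.2 (by linarith)))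

lemma summable_gBound (hq : ‖q‖ < 1) :
    Summable fun n : ℕ => (1 - ‖q‖)⁻¹ * (‖q‖ ^ n ^ 2 * (2 * (1 - ‖q‖)⁻¹ ^ 2) ^ n) :=
  (summable_pow_sq_mul (norm_nonneg _) hq
    (mul_nonneg zero_le_two (pow_nonneg (inv_nonneg.2 (by linarith)) _))).mul_left _

lemma summable_fTerm (hq : ‖q‖ < 1) (hx : ‖x‖ ≤ 1) : Summable (fTerm q x) :=
  Summable.of_norm_bounded (summable_fBound hq) (norm_fTerm_le hq hx)

lemma summable_gTerm (hq : ‖q‖ < 1) (hx : ‖x‖ ≤ 1) : Summable (gTerm q x) :=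
  Summable.of_norm_bounded (summable_gBound hq) (norm_gTerm_le hq hx)

lemma one_sub_ne_zero_of_norm_lt {y : ℂ} (hy : ‖y‖ < 1) : 1 - y ≠ 0 := by
  intro h
  rw [sub_eq_zero] at h
  rw [← h, norm_one] at hy
  exact lt_irrefl _ hy

lemma norm_sq_lt_one (hq : ‖q‖ < 1) : ‖q ^ 2‖ < 1 := by
  rw [norm_pow]; exact pow_lt_one₀ (norm_nonneg _) hq two_ne_zero

lemma tsum_fTerm (hq : ‖q‖ < 1) (hx : ‖x‖ ≤ 1) :
    ∑' n, fTerm q x n = 1 + fgFactor q x * ∑' n, fTerm q (q ^ 2 * x) n := by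
  rw [(summable_fTerm hq hx).tsum_eq_zero_add, ← tsum_mul_left]
  congr 1
  · simp [fTerm, qPoch_zero]
  · refine tsum_congr fun n => ?_
    have hxq := (norm_mul_le_of_norm_le_one (q := q) hx).trans_lt hq
    have h1 := one_sub_ne_zero_of_norm_lt hxq
    have h2 : qPoch (q ^ 2 * (x * q)) (q ^ 2) n ≠ 0 := by
      refine qPoch_ne_zero (norm_sq_lt_one hq) ?_ n
      exact (norm_mul_le_of_norm_le_one (norm_sq_le_one hq)).trans_lt hxq
    rw [fTerm, fTerm, fgFactor, qPoch_succ', qPoch_succ',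
      show q ^ 2 * -(x * q) = -(q ^ 2 * x * q) by ring,
      show q ^ 2 * (x * q) = q ^ 2 * x * q by ring] at *
    field_simp
    ring

/-- The equation for `G` is proved by telescoping: with
`h_n = x^{2n} q^{2n²} (-q²; q⁴)_n / (xq; q²)_{2n}`, the `n`-th terms of `G(x)` and of
`fgFactor(x) G(q² x)` differ by `h_n - h_{n+1}`. -/
lemma tsum_gTerm (hq : ‖q‖ < 1) (hx : ‖x‖ ≤ 1) :
    ∑' n, gTerm q x n = 1 + fgFactor q x * ∑' n, gTerm q (q ^ 2 * x) n := by
  have hxq := (norm_mul_le_of_norm_le_one (q := q) hx).trans_lt hq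
  have h1 := one_sub_ne_zero_of_norm_lt hxq
  set t : ℕ → ℂ := fun n => gTerm q x n * (1 - (q ^ 2) ^ (2 * n) * (x * q)) with ht
  have hP (n : ℕ) : qPoch (x * q) (q ^ 2) n ≠ 0 := qPoch_ne_zero (norm_sq_lt_one hq) hxq n
  have hF (n : ℕ) : 1 - (q ^ 2) ^ n * (x * q) ≠ 0 :=
    sub_ne_zero.2 (pow_mul_ne_one (norm_sq_lt_one hq) hxq n).symm
  have hts : Summable t := by
    refine Summable.of_norm_bounded ((summable_gBound hq).mul_right 2) fun n => ?_
    rw [ht, norm_mul]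
    refine mul_le_mul (norm_gTerm_le hq hx n) ?_ (norm_nonneg _)
      ((norm_nonneg _).trans (norm_gTerm_le hq hx n))
    refine (norm_sub_le _ _).trans ?_
    rw [norm_one, norm_mul, norm_pow]
    have := mul_le_one₀ (pow_le_one₀ (norm_nonneg _) (norm_sq_le_one hq) (n := 2 * n))
      (norm_nonneg _) hxq.le
    linarith
  have h0 : t 0 = 1 := by
    simp [ht, gTerm, qPoch]
    field_simp
  have hx2 : ‖q ^ 2 * x‖ ≤ 1 := by
    rw [norm_mul]; exact mul_le_one₀ (norm_sq_le_one hq) (norm_nonneg _) hx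
  have hsum := hts.tsum_eq_zero_add
  rw [h0] at hsum
  have key : ∀ n, gTerm q x n = t n - t (n + 1) + fgFactor q x * gTerm q (q ^ 2 * x) n := by
    intro n
    have e1 : (1 - x * q) * qPoch (q ^ 2 * x * q) (q ^ 2) (2 * n + 1) =
        qPoch (x * q) (q ^ 2) (2 * n) * (1 - (q ^ 2) ^ (2 * n) * (x * q)) *
          (1 - (q ^ 2) ^ (2 * n + 1) * (x * q)) := by
      rw [← qPoch_succ, ← qPoch_succ, qPoch_succ' _ _ (2 * n + 1)]
      ring_nf
    have e2 : qPoch (q ^ 2 * x * q) (q ^ 2) (2 * n + 1) =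
        qPoch (x * q) (q ^ 2) (2 * n) * (1 - (q ^ 2) ^ (2 * n) * (x * q)) *
          (1 - (q ^ 2) ^ (2 * n + 1) * (x * q)) / (1 - x * q) := by
      rw [← e1, mul_div_cancel_left₀ _ h1]
    rw [ht]
    simp only [gTerm, fgFactor]
    rw [e2, show 2 * (n + 1) + 1 = 2 * n + 1 + 1 + 1 by ring, qPoch_succ _ _ (2 * n + 1 + 1),
      qPoch_succ _ _ (2 * n + 1), qPoch_succ _ _ (2 * n), qPoch_succ _ _ n,
      show 2 * (n + 1) = 2 * n + 1 + 1 by ring]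
    have a1 := hP (2 * n)
    have a2 := hF (2 * n)
    have a3 := hF (2 * n + 1)
    have a4 := hF (2 * n + 1 + 1)
    have p1 : q ^ (2 * (n + 1) ^ 2) = q ^ (2 * n ^ 2) * (q ^ n) ^ 4 * q ^ 2 := by ring
    have p2 : (q ^ 2) ^ (2 * n) = (q ^ n) ^ 4 := by ring
    have p3 : (q ^ 4) ^ n = (q ^ n) ^ 4 := by ring
    rw [p2] at a2
    rw [pow_succ (q ^ 2) (2 * n), p2] at a3
    rw [pow_succ (q ^ 2) (2 * n + 1), pow_succ (q ^ 2) (2 * n), p2] at a4 ⊢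
    rw [p1, p3, mul_pow, ← pow_mul q 2 (2 * n), show 2 * (2 * n) = n * 4 by ring, pow_mul q n 4]
    generalize q ^ n = b at *
    generalize hd1 : 1 - b ^ 4 * (x * q) = d1 at *
    generalize hd2 : 1 - b ^ 4 * q ^ 2 * (x * q) = d2 at *
    generalize hd3 : 1 - b ^ 4 * q ^ 2 * q ^ 2 * (x * q) = d3 at *
    generalize qPoch (x * q) (q ^ 2) (2 * n) = P at *
    generalize hd0 : 1 - x * q = d0 at *
    field_simp
    simp only [← hd1, ← hd2]
    ring
  rw [tsum_congr key, Summable.tsum_add (hts.sub ((summable_nat_add_iff 1).2 hts))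
    ((summable_gTerm hq hx2).mul_left _), hts.tsum_sub ((summable_nat_add_iff 1).2 hts), hsum,
    tsum_mul_left]
  ring

lemma tsum_fTerm_eq_tsum_gTerm (hq : ‖q‖ < 1) : ∑' n, fTerm q 1 n = ∑' n, gTerm q 1 n := by
  have hx (n : ℕ) : ‖(q ^ 2) ^ n‖ ≤ 1 := by
    rw [norm_pow]; exact pow_le_one₀ (norm_nonneg _) (norm_sq_le_one hq)
  have h := eq_zero_of_eq_mul_succ
    (D := fun n => ∑' k, fTerm q ((q ^ 2) ^ n) k - ∑' k, gTerm q ((q ^ 2) ^ n) k)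
    (K := fun n => fgFactor q ((q ^ 2) ^ n))
    (M := ∑' n : ℕ, ‖q‖ ^ n ^ 2 * (2 * (1 - ‖q‖)⁻¹) ^ n +
      ∑' n : ℕ, (1 - ‖q‖)⁻¹ * (‖q‖ ^ n ^ 2 * (2 * (1 - ‖q‖)⁻¹ ^ 2) ^ n)) (fun n => ?_) (fun n => ?_) ?_
  · simpa [sub_eq_zero] using h
  · rw [tsum_fTerm hq (hx n), tsum_gTerm hq (hx n), pow_succ']
    ring_nf
  · refine (norm_sub_le _ _).trans (add_le_add ?_ ?_)
    · exact tsum_of_norm_bounded (summable_fBound hq).hasSum (norm_fTerm_le hq (hx n))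
    · exact tsum_of_norm_bounded (summable_gBound hq).hasSum (norm_gTerm_le hq (hx n))
  · have hc : ContinuousAt (fgFactor q) 0 := by
      unfold fgFactor
      fun_prop (disch := simp)
    have h0 : fgFactor q 0 = 0 := by simp [fgFactor]
    have h1 := hc.tendsto.comp (tendsto_pow_atTop_nhds_zero_of_norm_lt_one (norm_sq_lt_one hq))
    rwa [h0] at h1

/-- The partial fraction expansion of `1 / ((z; q)_{n+1} (q/z; q)_n)`. Multiplying by one more pair
of factors changes the sum by multiples of the finite triple products at `z = 1` and `z = q`, both
of which vanish. -/
lemma hasSum_partialFraction (hq0 : q ≠ 0) (hq : ‖q‖ < 1) (hz : z ≠ 0)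
    (hne : ∀ k : ℤ, z * q ^ k ≠ 1) (n : ℕ) :
    HasSum (fun k : ℤ => thetaTerm q q k / (1 - z * q ^ k) *
      (qInvFact q (n - k) * qInvFact q (n + k)))
      (1 / (qPoch z q (n + 1) * qPoch (q / z) q n)) := by
  have hF (k : ℤ) : 1 - z * q ^ k ≠ 0 := sub_ne_zero.2 (hne k).symm
  induction n with
  | zero =>
    have h := hasSum_single (f := fun k : ℤ => thetaTerm q q k / (1 - z * q ^ k) *
      (qInvFact q ((0 : ℕ) - k) * qInvFact q ((0 : ℕ) + k))) 0 (fun k hk => by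
        rcases lt_or_gt_of_ne hk with h | h
        · rw [qInvFact_of_neg q (n := ((0 : ℕ) : ℤ) + k) (by simpa using h)]; simp
        · rw [qInvFact_of_neg q (n := ((0 : ℕ) : ℤ) - k) (by simpa using h)]; simp)
    simpa [thetaTerm_zero, qPoch, qInvFact] using h
  | succ n ih =>
    have h1 : qPoch 1 q (n + 1) = 0 := by rw [qPoch_succ']; simp
    have f1 := hasSum_finite_triple_product hq0 hq (one_ne_zero) (n + 1)
    have f2 := hasSum_finite_triple_product hq0 hq hq0 (n + 1)
    rw [h1, zero_mul, zero_mul] at f1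
    rw [div_self hq0, h1, mul_zero, zero_mul] at f2
    have hA1 : 1 - z * q ^ (n + 1) ≠ 0 := by
      have := hF ((n + 1 : ℕ) : ℤ)
      rwa [zpow_natCast] at this
    have hA2 : 1 - q ^ (n + 1) / z ≠ 0 := by
      intro h
      refine hF (-((n + 1 : ℕ) : ℤ)) ?_
      rw [zpow_neg, zpow_natCast]
      rw [sub_eq_zero, eq_div_iff hz, one_mul] at h
      rw [← h, mul_inv_cancel₀ hz, sub_self]
    have h2 := ((ih.add (f1.mul_left (q ^ (n + 1)))).sub
      (f2.mul_left (q ^ (n + 1) / z))).mul_left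
      ((1 - z * q ^ (n + 1)) * (1 - q ^ (n + 1) / z))⁻¹
    refine h2.of_eq (fun k => ?_) ?_
    · rw [eq_inv_mul_iff_mul_eq₀ (mul_ne_zero hA1 hA2)]
      have e1 : qInvFact q (n - k) = (1 - q ^ ((n : ℤ) + 1 - k)) * qInvFact q (n + 1 - k) := by
        rw [← qInvFact_sub_one hq]; ring_nf
      have e2 : qInvFact q (n + k) = (1 - q ^ ((n : ℤ) + 1 + k)) * qInvFact q (n + 1 + k) := by
        rw [← qInvFact_sub_one hq]; ring_nf
      have p1 : q ^ ((n : ℤ) + 1 - k) = q ^ (n + 1) / q ^ k := by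
        rw [zpow_sub₀ hq0]; norm_cast
      have p2 : q ^ ((n : ℤ) + 1 + k) = q ^ (n + 1) * q ^ k := by
        rw [zpow_add₀ hq0]; norm_cast
      have hk := zpow_ne_zero k hq0
      have hFk := hF k
      push_cast
      rw [e1, e2, p1, p2, thetaTerm_eq_one_mul q]
      field_simp
      ring
    · rw [eq_inv_mul_iff_mul_eq₀ (mul_ne_zero hA1 hA2), qPoch_succ z q (n + 1),
        qPoch_succ (q / z) q n]
      have e3 : 1 - q ^ n * (q / z) = 1 - q ^ (n + 1) / z := by rw [pow_succ]; ring
      rw [e3, mul_comm (q ^ (n + 1)) z, mul_zero, mul_zero, add_zero, sub_zero]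
      generalize 1 - z * q ^ (n + 1) = a at *
      generalize 1 - q ^ (n + 1) / z = b at *
      rw [show qPoch z q (n + 1) * a * (qPoch (q / z) q n * b) =
        (a * b) * (qPoch z q (n + 1) * qPoch (q / z) q n) by ring, ← mul_div_assoc, mul_one,
        div_mul_cancel_left₀ (mul_ne_zero hA1 hA2), one_div]

/-! ### Sums of Bailey type with the weights `(-s; s²)_n s^{n²}` -/

/-- The weights `(-s; s²)_n s^{n²}`; for `s = q²` they are the numerators of `G(1)`. -/
def baileyWeight (s : ℂ) (n : ℕ) : ℂ := qPoch (-s) (s ^ 2) n * s ^ n ^ 2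

/-- The sums `∑_n (-s; s²)_n s^{n²} / ((s²; s²)_{n-k} (s²; s²)_{n+k})`. -/
def baileySum (s : ℂ) (k : ℤ) : ℂ :=
  ∑' n : ℕ, baileyWeight s n * (qInvFact (s ^ 2) (n - k) * qInvFact (s ^ 2) (n + k))

variable {s : ℂ}

lemma summable_norm_baileyWeight (hs : ‖s‖ < 1) : Summable fun n => ‖baileyWeight s n‖ := by
  refine (summable_pow_sq_mul (norm_nonneg _) hs zero_le_two).of_nonneg_of_le
    (fun _ => norm_nonneg _) fun n => ?_
  rw [baileyWeight, norm_mul, norm_pow, mul_comm]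
  gcongr
  exact norm_qPoch_le (norm_sq_le_one hs) (by rw [norm_neg]; exact hs.le) n

lemma summable_baileySum (hs : ‖s‖ < 1) (a b : ℤ) :
    Summable fun n : ℕ => baileyWeight s n *
      (qInvFact (s ^ 2) (n - a) * qInvFact (s ^ 2) (n + b)) := by
  obtain ⟨C, hC⟩ := exists_norm_qInvFact_le (norm_sq_lt_one hs)
  have hC0 : 0 ≤ C := (norm_nonneg _).trans (hC 0)
  refine Summable.of_norm_bounded ((summable_norm_baileyWeight hs).mul_right (C * C)) fun n => ?_
  rw [norm_mul, norm_mul]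
  gcongr
  · exact hC _
  · exact hC _

/-- Creative telescoping: the summands of `baileySum (k + 1) - s^{2k+1} baileySum k` are the
differences of `-(1 - s^{2k+1}) baileyWeight n / ((s²; s²)_{n-k-1} (s²; s²)_{n+k})`. -/
lemma baileySum_add_one (hs0 : s ≠ 0) (hs : ‖s‖ < 1) (k : ℤ) :
    baileySum s (k + 1) = -((s ^ 2) ^ k * -s) * baileySum s k := by
  have hq := norm_sq_lt_one hs
  have hq0 : s ^ 2 ≠ 0 := pow_ne_zero _ hs0
  set a : ℂ := (s ^ 2) ^ k * s with ha
  have ha0 : a ≠ 0 := mul_ne_zero (zpow_ne_zero _ hq0) hs0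
  have h1 := (summable_baileySum hs (k + 1) k).mul_left (-(1 - a))
  have h2 := h1.tsum_eq_zero_add
  have h0 : baileyWeight s 0 * (qInvFact (s ^ 2) ((0 : ℕ) - (k + 1)) *
      qInvFact (s ^ 2) ((0 : ℕ) + k)) = 0 := by
    rcases lt_or_ge k 0 with h | h
    · rw [qInvFact_of_neg _ (n := ((0 : ℕ) : ℤ) + k) (by simpa using h)]; simp
    · rw [qInvFact_of_neg _ (n := ((0 : ℕ) : ℤ) - (k + 1)) (by push_cast; omega)]; simp
  rw [h0, mul_zero, zero_add] at h2
  have h3 : ∀ n : ℕ, baileyWeight s n * (qInvFact (s ^ 2) (n - (k + 1)) *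
        qInvFact (s ^ 2) (n + (k + 1))) =
      a * (baileyWeight s n * (qInvFact (s ^ 2) (n - k) * qInvFact (s ^ 2) (n + k))) +
      (-(1 - a) * (baileyWeight s (n + 1) * (qInvFact (s ^ 2) ((n + 1 : ℕ) - (k + 1)) *
        qInvFact (s ^ 2) ((n + 1 : ℕ) + k))) -
      -(1 - a) * (baileyWeight s n * (qInvFact (s ^ 2) (n - (k + 1)) *
        qInvFact (s ^ 2) (n + k)))) := by
    intro n
    have e1 : qInvFact (s ^ 2) (n - (k + 1)) =
        (1 - (s ^ 2) ^ ((n : ℤ) - k)) * qInvFact (s ^ 2) (n - k) := by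
      rw [← qInvFact_sub_one hq]; ring_nf
    have e2 : qInvFact (s ^ 2) (n + k) =
        (1 - (s ^ 2) ^ ((n : ℤ) + (k + 1))) * qInvFact (s ^ 2) (n + (k + 1)) := by
      rw [← qInvFact_sub_one hq]; ring_nf
    have e3 : qInvFact (s ^ 2) ((n + 1 : ℕ) - (k + 1)) = qInvFact (s ^ 2) (n - k) := by
      push_cast; ring_nf
    have e4 : qInvFact (s ^ 2) ((n + 1 : ℕ) + k) = qInvFact (s ^ 2) (n + (k + 1)) := by
      push_cast; ring_nf
    have p1 : (s ^ 2) ^ ((n : ℤ) - k) = (s ^ n) ^ 2 * s / a := by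
      rw [ha, zpow_sub₀ hq0, zpow_natCast]
      field_simp
      ring
    have p2 : (s ^ 2) ^ ((n : ℤ) + (k + 1)) = (s ^ n) ^ 2 * s * a := by
      rw [ha, zpow_add₀ hq0, zpow_add_one₀ hq0, zpow_natCast]
      ring
    have p3 : baileyWeight s (n + 1) =
        baileyWeight s n * ((1 + (s ^ n) ^ 2 * s) * ((s ^ n) ^ 2 * s)) := by
      rw [baileyWeight, baileyWeight, qPoch_succ]
      ring
    rw [e3, e4, e1, e2, p1, p2, p3]
    field_simp
    ring
  rw [baileySum, tsum_congr h3, Summable.tsum_add ((summable_baileySum hs k k).mul_left _)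
    (((summable_nat_add_iff 1).2 h1).sub h1), Summable.tsum_sub ((summable_nat_add_iff 1).2 h1) h1,
    h2, sub_self, add_zero, tsum_mul_left, ha, baileySum]
  ring

lemma baileySum_eq (hs0 : s ≠ 0) (hs : ‖s‖ < 1) (k : ℤ) :
    baileySum s k = thetaTerm (-s) (s ^ 2) k * baileySum s 0 :=
  eq_thetaTerm_mul (pow_ne_zero _ hs0) (neg_ne_zero.2 hs0) (baileySum_add_one hs0 hs) k

/-- A sequence with `n`-th term `∑_k c_k / ((s²; s²)_{n-k} (s²; s²)_{n+k})` is summed against the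
weights by interchanging the summations. -/
lemma hasSum_baileyWeight_mul (hs : ‖s‖ < 1) {c : ℤ → ℂ} (hc : Summable fun k => ‖c k‖)
    {d : ℕ → ℂ} (hd : ∀ n : ℕ, HasSum (fun k : ℤ => c k * (qInvFact (s ^ 2) (n - k) *
      qInvFact (s ^ 2) (n + k))) (d n)) :
    HasSum (fun n => baileyWeight s n * d n) (∑' k, c k * baileySum s k) := by
  obtain ⟨C, hC⟩ := exists_norm_qInvFact_le (norm_sq_lt_one hs)
  have hC0 : 0 ≤ C := (norm_nonneg _).trans (hC 0)
  have h1 : Summable fun p : ℕ × ℤ => baileyWeight s p.1 * (c p.2 *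
      (qInvFact (s ^ 2) (p.1 - p.2) * qInvFact (s ^ 2) (p.1 + p.2))) := by
    refine Summable.of_norm_bounded (((summable_norm_baileyWeight hs).mul_of_nonneg hc
      (fun _ => norm_nonneg _) (fun _ => norm_nonneg _)).mul_right (C * C)) fun p => ?_
    rw [norm_mul, norm_mul, norm_mul, mul_assoc]
    gcongr
    · exact hC _
    · exact hC _
  have h2 := h1.hasSum.prod_fiberwise fun n => (hd n).mul_left (baileyWeight s n)
  have h3 := ((Equiv.prodComm ℤ ℕ).hasSum_iff.2 h1.hasSum).prod_fiberwise
    (g := fun k => c k * baileySum s k) fun k =>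
      ((summable_baileySum hs k k).hasSum.mul_left (c k)).of_eq
        (fun n => by simp only [Function.comp, Equiv.prodComm_apply, Prod.swap]; ring) rfl
  rwa [← h3.tsum_eq] at h2

/-- The value of `baileySum s 0` follows from the orthogonality relation
`∑_k (-1)^k q^{k(k-1)/2} / ((q; q)_{n-k} (q; q)_{n+k}) = 0` for `n ≥ 1`. -/
lemma j_mul_baileySum_zero (hs0 : s ≠ 0) (hs : ‖s‖ < 1) : j s (s ^ 4) * baileySum s 0 = 1 := by
  have hq := norm_sq_lt_one hs
  have hq0 : s ^ 2 ≠ 0 := pow_ne_zero _ hs0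
  have hq4 : ‖s ^ 4‖ < 1 := by rw [norm_pow]; exact pow_lt_one₀ (norm_nonneg _) hs (by norm_num)
  have h1 := hasSum_baileyWeight_mul hs (summable_norm_thetaTerm hq0 hq one_ne_zero)
    (hasSum_finite_triple_product hq0 hq one_ne_zero)
  have h2 := hasSum_single (f := fun n : ℕ => baileyWeight s n *
    (qPoch 1 (s ^ 2) n * qPoch (s ^ 2 / 1) (s ^ 2) n * qInvFact (s ^ 2) (2 * n))) 0 fun n hn => by
      obtain ⟨k, rfl⟩ := Nat.exists_eq_succ_of_ne_zero hn
      rw [Nat.succ_eq_add_one, qPoch_succ' 1]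
      simp
  have h3 := h1.unique h2
  simp only [baileyWeight, qPoch_zero, qInvFact] at h3
  norm_num [qPoch_zero] at h3
  rw [← h3, ← (hasSum_thetaTerm (pow_ne_zero 4 hs0) hq4 hs0).tsum_eq, ← tsum_mul_right]
  refine tsum_congr fun k => ?_
  rw [baileySum_eq hs0 hs k, ← mul_assoc]
  congr 1
  have p1 : (s ^ 4) ^ (k * (k - 1) / 2) =
      (s ^ 2) ^ (k * (k - 1) / 2) * (s ^ 2) ^ (k * (k - 1) / 2) := by
    rw [← mul_zpow]; ring_nf
  rw [thetaTerm, thetaTerm, thetaTerm, p1, one_zpow, neg_eq_neg_one_mul s, mul_zpow]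
  have : ((-1 : ℂ) ^ k) * (-1) ^ k = 1 := by rw [← mul_zpow]; simp
  linear_combination -((-1) ^ k * (s ^ 2) ^ (k * (k - 1) / 2) * (s ^ 2) ^ (k * (k - 1) / 2) * s ^ k)
    * this

lemma thetaTerm_mul_thetaTerm (s : ℂ) (k : ℤ) :
    thetaTerm (s ^ 2) (s ^ 2) k * thetaTerm (-s) (s ^ 2) k = thetaTerm (s ^ 3) (s ^ 4) k := by
  have p1 : (s ^ 4) ^ (k * (k - 1) / 2) =
      (s ^ 2) ^ (k * (k - 1) / 2) * (s ^ 2) ^ (k * (k - 1) / 2) := by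
    rw [← mul_zpow]; ring_nf
  have p2 : (s ^ 3) ^ k = (s ^ 2) ^ k * s ^ k := by rw [← mul_zpow]; ring_nf
  rw [thetaTerm, thetaTerm, thetaTerm, p1, p2, neg_eq_neg_one_mul s, mul_zpow]
  have : ((-1 : ℂ) ^ k) * (-1) ^ k = 1 := by rw [← mul_zpow]; simp
  linear_combination ((-1) ^ k * (s ^ 2) ^ (k * (k - 1) / 2) * (s ^ 2) ^ (k * (k - 1) / 2) *
    (s ^ 2) ^ k * s ^ k) * this

lemma qPoch_two_mul_add_one (hq0 : q ≠ 0) (n : ℕ) :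
    qPoch q (q ^ 2) (2 * n + 1) = qPoch q (q ^ 4) (n + 1) * qPoch (q ^ 4 / q) (q ^ 4) n := by
  induction n with
  | zero => simp [qPoch]
  | succ n ih =>
    rw [show 2 * (n + 1) + 1 = 2 * n + 1 + 1 + 1 by ring, qPoch_succ _ _ (2 * n + 1 + 1),
      qPoch_succ _ _ (2 * n + 1), ih, qPoch_succ q (q ^ 4) (n + 1), qPoch_succ (q ^ 4 / q) (q ^ 4) n]
    have e1 : (q ^ 2) ^ (2 * n + 1 + 1) * q = (q ^ 4) ^ (n + 1) * q := by ring
    have e2 : (q ^ 2) ^ (2 * n + 1) * q = (q ^ 4) ^ n * (q ^ 4 / q) := by field_simp; ring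
    rw [e1, e2]
    ring

/-- `V₀` as a Lerch-type series:
`1 + V₀(q) = 2 / j(q²; q⁸) · ∑_k (-1)^k q^{4k²+2k} / (1 - q^{4k+1})`. -/
lemma V0_eq_lerch (hq0 : q ≠ 0) (hq : ‖q‖ < 1) :
    V0 q = -1 + 2 * ((j (q ^ 2) (q ^ 8))⁻¹ *
      ∑' k : ℤ, thetaTerm (q ^ 6) (q ^ 8) k / (1 - q * (q ^ 4) ^ k)) := by
  have h0 : V0 q = -1 + 2 * ∑' n, fTerm q 1 n := by
    rw [V0]
    simp only [fTerm, one_pow, one_mul]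
  have hs0 : q ^ 2 ≠ 0 := pow_ne_zero _ hq0
  have hs := norm_sq_lt_one hq
  have hq4 : ‖q ^ 4‖ < 1 := by rw [norm_pow]; exact pow_lt_one₀ (norm_nonneg _) hq (by norm_num)
  have hlt : ‖q ^ 4‖ < ‖q‖ := by
    rw [norm_pow]
    exact pow_lt_self_of_lt_one₀ (norm_pos_iff.2 hq0) hq (by norm_num)
  have hq1 : q ≠ 1 := by rintro rfl; simp at hq
  have hne := mul_zpow_ne_one (pow_ne_zero 4 hq0) hlt hq.le hq1
  have e4 : (q ^ 2) ^ 2 = q ^ 4 := by ring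
  obtain ⟨C, hC⟩ := exists_norm_inv_one_sub_le (pow_ne_zero 4 hq0) hq4 hq0
  have hc : Summable fun k : ℤ => ‖thetaTerm (q ^ 4) (q ^ 4) k / (1 - q * (q ^ 4) ^ k)‖ := by
    refine ((summable_norm_thetaTerm (pow_ne_zero 4 hq0) hq4 (pow_ne_zero 4 hq0)).mul_right
      C).of_nonneg_of_le (fun _ => norm_nonneg _) fun k => ?_
    rw [div_eq_mul_inv, norm_mul]
    gcongr
    exact (hC k).1
  have hpf := hasSum_partialFraction (pow_ne_zero 4 hq0) hq4 hq0 hne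
  rw [← e4] at hpf hc
  have h1 := hasSum_baileyWeight_mul hs hc hpf
  rw [h0, tsum_fTerm_eq_tsum_gTerm hq]
  congr 2
  have hj := j_mul_baileySum_zero hs0 hs
  rw [show (q ^ 2) ^ 4 = q ^ 8 by ring] at hj
  have hj0 : (j (q ^ 2) (q ^ 8))⁻¹ = baileySum (q ^ 2) 0 := inv_eq_of_mul_eq_one_right hj
  rw [hj0, ← tsum_mul_left]
  calc ∑' n, gTerm q 1 n = _ := ?_
    _ = _ := h1.tsum_eq
    _ = _ := ?_
  · refine tsum_congr fun n => ?_
    rw [gTerm, baileyWeight, one_mul, qPoch_two_mul_add_one hq0, e4, one_pow, one_mul, ← pow_mul,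
      mul_one_div]
    ring
  · refine tsum_congr fun k => ?_
    rw [baileySum_eq hs0 hs k, show q ^ 6 = (q ^ 2) ^ 3 by ring, show q ^ 8 = (q ^ 2) ^ 4 by ring,
      ← thetaTerm_mul_thetaTerm]
    ring_nf

end Transformation

/-! ### `V₀` as a sum of two Appell functions -/

section EvenPart

variable {q : ℂ}

lemma norm_pow_lt_norm_pow (hq0 : q ≠ 0) (hq : ‖q‖ < 1) {a b : ℕ} (h : b < a) :
    ‖q ^ a‖ < ‖q ^ b‖ := by
  rw [norm_pow, norm_pow]
  exact pow_lt_pow_right_of_lt_one₀ (norm_pos_iff.2 hq0) hq h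

lemma norm_pow_lt_one' (hq : ‖q‖ < 1) {a : ℕ} (h : a ≠ 0) : ‖q ^ a‖ < 1 := by
  rw [norm_pow]
  exact pow_lt_one₀ (norm_nonneg _) hq h

/-- The general term of the theta series of `j(q²; q⁸)`, in the form in which it occurs in the
expansion of `lambert (-q) q (q^4)` along diagonals. -/
lemma thetaTerm_six_eight (hq0 : q ≠ 0) (k : ℤ) :
    thetaTerm (q ^ 6) (q ^ 8) k = (-1) ^ k * q ^ (4 * (k * k) + 2 * k) := by
  rw [thetaTerm, ← zpow_natCast, ← zpow_natCast, ← zpow_mul, ← zpow_mul, mul_assoc,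
    ← zpow_add₀ hq0]
  congr 2
  push_cast
  linarith [two_mul_tri k]

lemma one_sub_ne_zero_of_ne_one {y : ℂ} (hy : y ≠ 1) : 1 - y ≠ 0 := sub_ne_zero.2 hy.symm

/-- The double series of `lambert (-q) q (q^4)` is cut along the diagonal; each half is summed
first over the distance to the diagonal. -/
lemma hasSum_even_part (hq0 : q ≠ 0) (hq : ‖q‖ < 1) :
    HasSum (fun k : ℤ => thetaTerm (q ^ 6) (q ^ 8) k *
      ((1 + (q * (q ^ 4) ^ k) ^ 2) / (1 - (q * (q ^ 4) ^ k) ^ 2))) (lambert (-q) q (q ^ 4)) := by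
  have hlt : ‖q ^ 4‖ < ‖q‖ := by simpa using norm_pow_lt_norm_pow hq0 hq (show 1 < 4 by norm_num)
  have h40 := pow_ne_zero 4 hq0
  have h4 := hlt.trans hq
  have hlt' : ‖q ^ 4‖ < ‖-q‖ := by rwa [norm_neg]
  have hq' : ‖-q‖ < 1 := by rwa [norm_neg]
  have hs := hasSum_hyp_prod h40 hlt hq hlt' hq'
  set base : ℤ × ℤ → ℂ := fun p => q ^ p.1 * (-q) ^ p.2 * (q ^ 4) ^ (p.1 * p.2) with hbase
  -- `F` is the half `|k| ≥ |l|` of the double series and `G` the half `|k| < |l|`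
  set F : ℤ × ℤ → ℂ := fun p => (hypSign p.2 (p.1 - p.2) -
    if p.1 = p.2 ∧ p.2 < 0 then 1 else 0) * base p with hF
  set G : ℤ × ℤ → ℂ := fun p => (hypSign p.1 (p.2 - p.1) -
    if p.1 = p.2 ∧ 0 ≤ p.1 then 1 else 0) * base p with hG
  have hFG : ∀ p : ℤ × ℤ, hypSign p.1 p.2 * base p = F p + G p := by
    rintro ⟨k, l⟩
    simp only [hF, hG]
    rw [← add_mul]
    congr 1
    simp only [hypSign]
    split_ifs <;> first | omega | norm_num
  have hFs : Summable F := by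
    refine Summable.of_norm_bounded (summable_norm_hyp h40 hlt hq hlt' hq') fun p => ?_
    obtain ⟨k, l⟩ := p
    rw [norm_mul (hypSign _ _), hF, norm_mul]
    refine mul_le_mul_of_nonneg_right ?_ (norm_nonneg _)
    simp only [hypSign]
    split_ifs <;> first | omega | norm_num
  have hGs : Summable G := by
    refine Summable.of_norm_bounded (summable_norm_hyp h40 hlt hq hlt' hq') fun p => ?_
    obtain ⟨k, l⟩ := p
    rw [norm_mul (hypSign _ _), hG, norm_mul]
    refine mul_le_mul_of_nonneg_right ?_ (norm_nonneg _)
    simp only [hypSign]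
    split_ifs <;> first | omega | norm_num
  set θ : ℤ → ℂ := thetaTerm (q ^ 6) (q ^ 8) with hθ
  set Y : ℤ → ℂ := fun k => q * (q ^ 4) ^ k with hY
  have b1 : ∀ l d : ℤ, base (l + d, l) = θ l * Y l ^ d := by
    intro l d
    simp only [hbase, hθ, hY]
    rw [thetaTerm_six_eight hq0, neg_eq_neg_one_mul q, mul_zpow, mul_zpow, ← zpow_natCast q 4,
      ← zpow_mul, ← zpow_mul, ← zpow_mul]
    rw [show q ^ (l + d) * ((-1) ^ l * q ^ l) * q ^ (((4 : ℕ) : ℤ) * ((l + d) * l)) =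
      (-1) ^ l * (q ^ (l + d) * q ^ l * q ^ (((4 : ℕ) : ℤ) * ((l + d) * l))) by ring,
      mul_assoc ((-1) ^ l), ← zpow_add₀ hq0, ← zpow_add₀ hq0, ← zpow_add₀ hq0, ← zpow_add₀ hq0]
    congr 2
    push_cast
    ring
  have b2 : ∀ k d : ℤ, base (k, k + d) = θ k * (-Y k) ^ d := by
    intro k d
    have h1 : ((-1 : ℂ) ^ k) * (-1) ^ k = 1 := by rw [← mul_zpow]; simp
    have h2 : q ^ d * base (k, k + d) = (-q) ^ d * base (k + d, k) := by
      simp only [hbase]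
      rw [zpow_add₀ hq0, zpow_add₀ (neg_ne_zero.2 hq0), mul_comm (k + d) k]
      ring
    have h3 := zpow_ne_zero d hq0
    rw [← mul_right_inj' h3, h2, b1, neg_eq_neg_one_mul q, neg_eq_neg_one_mul (Y k), mul_zpow,
      mul_zpow (-1) (Y k)]
    ring
  have hY1 : ∀ k, 0 ≤ k → ‖Y k‖ < 1 := fun k hk => norm_mul_zpow_lt h40 h4 hq hk
  have hY2 : ∀ k, k < 0 → 1 < ‖Y k‖ := fun k hk => one_lt_norm_mul_zpow h40 h4 hlt hk
  have hdelta : ∀ (P : Prop) [Decidable P] (u : ℂ),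
      HasSum (fun d : ℤ => (if d = 0 ∧ P then 1 else 0) * u ^ d) (if P then 1 else 0) := by
    intro P _ u
    have h := hasSum_single (f := fun d : ℤ => (if d = 0 ∧ P then (1 : ℂ) else 0) * u ^ d) 0
      (fun d hd => by rw [if_neg (fun h => hd h.1), zero_mul])
    simpa using h
  have f1 : ∀ l : ℤ, HasSum (fun d => F (l + d, l))
      (θ l * (1 / (1 - Y l) - if l < 0 then 1 else 0)) := by
    intro l
    refine (((hasSum_hypSign_mul_zpow (hY1 l) (hY2 l)).sub (hdelta (l < 0) (Y l))).mul_left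
      (θ l)).of_eq (fun d => ?_) rfl
    simp only [hF]
    rw [b1, show l + d - l = d by ring, ← sub_mul]
    have : (l + d = l ∧ l < 0) ↔ (d = 0 ∧ l < 0) := by omega
    simp only [this]
    ring
  have f2 : ∀ k : ℤ, HasSum (fun d => G (k, k + d))
      (θ k * (1 / (1 - -Y k) - if 0 ≤ k then 1 else 0)) := by
    intro k
    refine (((hasSum_hypSign_mul_zpow (u := -Y k) (by simpa using hY1 k)
      (by simpa using hY2 k)).sub (hdelta (0 ≤ k) (-Y k))).mul_left
      (θ k)).of_eq (fun d => ?_) rfl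
    simp only [hG]
    rw [b2, show k + d - k = d by ring, ← sub_mul]
    have : (k = k + d ∧ 0 ≤ k) ↔ (d = 0 ∧ 0 ≤ k) := by omega
    simp only [this]
    ring
  let e1 : ℤ × ℤ ≃ ℤ × ℤ := ⟨fun p => (p.1 + p.2, p.1), fun p => (p.2, p.1 - p.2),
    fun p => by simp, fun p => by simp⟩
  let e2 : ℤ × ℤ ≃ ℤ × ℤ := ⟨fun p => (p.1, p.1 + p.2), fun p => (p.1, p.2 - p.1),
    fun p => by simp, fun p => by simp⟩
  have s1 := (e1.hasSum_iff.2 hFs.hasSum).prod_fiberwise f1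
  have s2 := (e2.hasSum_iff.2 hGs.hasSum).prod_fiberwise f2
  have hsum : lambert (-q) q (q ^ 4) = ∑' p, F p + ∑' p, G p :=
    hs.unique ((hFs.hasSum.add hGs.hasSum).of_eq hFG rfl)
  refine (s1.add s2).of_eq (fun k => ?_) hsum
  have n1 : 1 - Y k ≠ 0 := by
    refine one_sub_ne_zero_of_ne_one (mul_zpow_ne_one h40 hlt hq.le ?_ k)
    rintro rfl; simp at hq
  have n2 : 1 + Y k ≠ 0 := by
    have := one_sub_ne_zero_of_ne_one (mul_zpow_ne_one (y := -q) h40 hlt' hq'.le (by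
      rintro h; rw [h] at hq'; simp at hq') k)
    simpa [hY] using this
  have e : (if k < 0 then (1 : ℂ) else 0) = 1 - if 0 ≤ k then 1 else 0 := by
    split_ifs <;> first | omega | norm_num
  rw [e, sub_neg_eq_add, show 1 - Y k ^ 2 = (1 - Y k) * (1 + Y k) by ring]
  field_simp
  ring

/-- Here `1 / (1 + Y) = 1 / (1 - Y²) - Y / (1 - Y²)` with `Y = q^{4k+1}`; in the second part `k` is
replaced by `-1 - k`. -/
lemma lambert_neg_eq_add (hq0 : q ≠ 0) (hq : ‖q‖ < 1) :
    lambert (-q) q (q ^ 4) =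
      lambert (q ^ 2) q (q ^ 8) + q ^ 2 * lambert (q ^ 6) (q ^ 3) (q ^ 8) := by
  have h1 : ‖q ^ 8‖ < ‖q‖ := by simpa using norm_pow_lt_norm_pow hq0 hq (show 1 < 8 by norm_num)
  have h3 : ‖q ^ 8‖ < ‖q ^ 3‖ := norm_pow_lt_norm_pow hq0 hq (by norm_num)
  have h30 := norm_pow_lt_one' hq (show 3 ≠ 0 by norm_num)
  have h4 : ‖q ^ 4‖ < ‖q‖ := by simpa using norm_pow_lt_norm_pow hq0 hq (show 1 < 4 by norm_num)
  have h80 := pow_ne_zero 8 hq0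
  have s0 := hasSum_lambert (y := -q) (pow_ne_zero 4 hq0) h4 hq (neg_ne_zero.2 hq0)
  have s1 := hasSum_lambert (y := q ^ 2) h80 h1 hq (pow_ne_zero 2 hq0)
  have s3 := (Equiv.subLeft (-1 : ℤ)).hasSum_iff.2
    (hasSum_lambert (y := q ^ 6) h80 h3 h30 (pow_ne_zero 6 hq0))
  refine s0.unique ((s1.add (s3.mul_left (q ^ 2))).of_eq (fun k => ?_) rfl)
  have n1 : 1 - q * (q ^ 4) ^ k ≠ 0 := by
    refine one_sub_ne_zero_of_ne_one
      (mul_zpow_ne_one (pow_ne_zero 4 hq0) h4 hq.le ?_ k)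
    rintro rfl; simp at hq
  have n2 : 1 + q * (q ^ 4) ^ k ≠ 0 := by
    have := one_sub_ne_zero_of_ne_one (mul_zpow_ne_one (y := -q) (pow_ne_zero 4 hq0)
      (by rwa [norm_neg]) (by rw [norm_neg]; exact hq.le) (by
      intro h; rw [← norm_neg, h] at hq; simp at hq) k)
    simpa using this
  have e1 : (q ^ 4) ^ k = (q ^ k) ^ 4 := by
    rw [← zpow_natCast, ← zpow_natCast, ← zpow_mul, ← zpow_mul, mul_comm]
  have e2 : (q ^ 8) ^ k = (q ^ k) ^ 8 := by
    rw [← zpow_natCast, ← zpow_natCast, ← zpow_mul, ← zpow_mul, mul_comm]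
  have e3 : (q ^ 8) ^ (-1 - k) = ((q ^ k) ^ 8 * q ^ 8)⁻¹ := by
    rw [show -1 - k = -(k + 1) by ring, zpow_neg, zpow_add_one₀ h80, e2]
  have e4 : (q ^ 3) ^ (-1 - k) = ((q ^ k) ^ 3 * q ^ 3)⁻¹ := by
    rw [show -1 - k = -(k + 1) by ring, zpow_neg, zpow_add_one₀ (pow_ne_zero 3 hq0),
      ← zpow_natCast q, ← zpow_natCast (q ^ k), ← zpow_mul, ← zpow_mul, mul_comm k]
  simp only [Function.comp, Equiv.subLeft_apply]
  rw [e3, e4, e2, e1]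
  rw [e1] at n1 n2
  have ha := zpow_ne_zero k hq0
  generalize q ^ k = a at *
  have n3 : 1 - q ^ 2 * a ^ 8 ≠ 0 := by
    rw [show 1 - q ^ 2 * a ^ 8 = (1 - q * a ^ 4) * (1 + q * a ^ 4) by ring]
    exact mul_ne_zero n1 n2
  have e5 : 1 - q ^ 6 * (a ^ 8 * q ^ 8)⁻¹ = -(1 - q ^ 2 * a ^ 8) / (q ^ 2 * a ^ 8) := by
    field_simp
    ring
  have e6 : 1 - -q * a ^ 4 = (1 - q ^ 2 * a ^ 8) / (1 - q * a ^ 4) := by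
    field_simp
    ring
  rw [e5, e6]
  field_simp
  ring

lemma j_div (x q : ℂ) (hq0 : q ≠ 0) : j (q / x) q = j x q := by
  rw [j, j, div_div_cancel₀ hq0]
  ring

/-- `V₀(q) = -q⁻¹ (m(1, q; q⁸) + m(1, q³; q⁸))`. -/
theorem V0_eq_m_add_m (hq0 : q ≠ 0) (hq : ‖q‖ < 1) :
    V0 q = -q⁻¹ * (m 1 q (q ^ 8) + m 1 (q ^ 3) (q ^ 8)) := by
  have h80 := pow_ne_zero 8 hq0
  have h20 := pow_ne_zero 2 hq0
  have h30 := pow_ne_zero 3 hq0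
  have hn {a b : ℕ} (h : b < a) := norm_pow_lt_norm_pow hq0 hq h
  have hl {a : ℕ} (h : a ≠ 0) := norm_pow_lt_one' hq h
  have h1 : ‖q ^ 8‖ < ‖q‖ := by simpa using hn (show 1 < 8 by norm_num)
  have h8 := hl (show 8 ≠ 0 by norm_num)
  have hne {a : ℕ} (h : a ≠ 0) : q ^ a ≠ 1 := fun h' => by
    have := hl h
    rw [h', norm_one] at this
    exact lt_irrefl _ this
  have hjne {a : ℕ} (h : a ≠ 0) (h' : a < 8) : j (q ^ a) (q ^ 8) ≠ 0 :=
    j_ne_zero h8 (hn h') (hl h).le (hne h)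
  have j1 : j q (q ^ 8) ≠ 0 := by simpa using hjne one_ne_zero (by norm_num)
  have j2 := hjne (a := 2) (by norm_num) (by norm_num)
  have j3 := hjne (a := 3) (by norm_num) (by norm_num)
  have hr1 : j (q ^ 2 * q ^ 3) (q ^ 8) = j (q ^ 3) (q ^ 8) := by
    rw [← j_div _ _ h80]; congr 1; field_simp
  have hr2 : j (q ^ 6) (q ^ 8) = j (q ^ 2) (q ^ 8) := by
    rw [← j_div _ _ h80]; congr 1; field_simp
  have hr3 : j (q ^ 6 * q ^ 3) (q ^ 8) = -q⁻¹ * j q (q ^ 8) := by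
    have h := j_mul_left h80 h8 hq0
    rw [show q ^ 6 * q ^ 3 = q ^ 8 * q by ring, ← mul_right_inj' hq0, h]
    field_simp
  -- both Appell functions are compared with `m(1, q²; q⁸)`
  have hz2 : ∀ k : ℤ, q ^ 2 * (q ^ 8) ^ k ≠ 1 :=
    mul_zpow_ne_one h80 (hn (by norm_num)) (hl (by norm_num)).le (hne (by norm_num))
  have m1 := m_one_split (h := 0) (z := q) (Z := q ^ 2) h80 h1 hq h20 (by simpa using j2)
    (by simpa using hz2)
  have m3 := m_one_split (h := 0) (z := q ^ 3) (Z := q ^ 2) h80 (hn (by norm_num))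
    (hl (by norm_num)) h20 (by simpa using j2) (by simpa using hz2)
  have l1 := lambert_eq (w := q ^ 3) (y := q ^ 2) h80 (hn (by norm_num)) (hl (by norm_num))
    (hn (by norm_num)) (hl (by norm_num)).le (hne (by norm_num))
  have l3 := lambert_eq (w := q ^ 3) (y := q ^ 6) h80 (hn (by norm_num)) (hl (by norm_num))
    (hn (by norm_num)) (hl (by norm_num)).le (hne (by norm_num))
  rw [hr1] at l1
  rw [hr2, hr3] at l3
  have hj1 : j (q / q ^ 2) (q ^ 8) = -q⁻¹ * j q (q ^ 8) := by
    rw [show q / q ^ 2 = q⁻¹ by field_simp, ← mul_right_inj' hq0, j_inv h80 h8 hq0]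
    field_simp
  have hj3 : j (q ^ 3 / q ^ 2) (q ^ 8) = j q (q ^ 8) := by
    congr 1; field_simp
  simp [splitCoeff, thetaTerm_zero, thetaTerm_one, hj1, hj3] at m1 m3
  -- the odd part of the series is a multiple of `m(1, q²; q⁸)`
  have o := ((hasSum_m h80 h8 one_ne_zero h20 j2).int_shift 1).mul_left (-q⁻¹)
  have t := hasSum_thetaTerm h80 h8 (pow_ne_zero 6 hq0)
  have s := (((hasSum_even_part hq0 hq).add (o.mul_left 2)).add t).mul_left (2⁻¹ : ℂ)
  have L := s.of_eq (g := fun k : ℤ => thetaTerm (q ^ 6) (q ^ 8) k / (1 - q * (q ^ 4) ^ k))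
    (fun k => ?_) rfl
  · rw [V0_eq_lerch hq0 hq, L.tsum_eq, lambert_neg_eq_add hq0 hq, hr2]
    rw [m1, m3]
    field_simp
    rw [l1, l3]
    field_simp
    ring
  · have e1 : (q ^ 8) ^ k = ((q ^ 4) ^ k) ^ 2 := by
      rw [← zpow_natCast, ← zpow_natCast, ← zpow_natCast, ← zpow_mul, ← zpow_mul, ← zpow_mul]
      congr 1
      push_cast
      ring
    have e2 : thetaTerm (q ^ 2) (q ^ 8) (k + 1) =
        -(q ^ 2 * (q ^ 4) ^ k * thetaTerm (q ^ 6) (q ^ 8) k) := by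
      have e3 : (q ^ 6) ^ k = (q ^ 2) ^ k * (q ^ 4) ^ k := by rw [← mul_zpow]; ring_nf
      rw [thetaTerm_add_one h80 h20, thetaTerm, thetaTerm, e1, e3]
      ring
    have n1 : 1 - q * (q ^ 4) ^ k ≠ 0 := one_sub_ne_zero_of_ne_one
      (mul_zpow_ne_one (pow_ne_zero 4 hq0) (by simpa using hn (show 1 < 4 by norm_num)) hq.le
        (by simpa using hne one_ne_zero) k)
    have n2 : 1 - (q * (q ^ 4) ^ k) ^ 2 ≠ 0 := by
      have := one_sub_ne_zero_of_ne_one (hz2 k)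
      rwa [e1, ← mul_pow] at this
    have e4 : 1 - (q ^ 8) ^ (k + 1 - 1) * 1 * q ^ 2 = 1 - (q * (q ^ 4) ^ k) ^ 2 := by
      rw [add_sub_cancel_right, e1]; ring
    rw [e2, e4]
    generalize (q ^ 4) ^ k = a at *
    have e5 : 1 - q * a = (1 - (q * a) ^ 2) / (1 + q * a) := by
      rw [eq_div_iff]
      · ring
      · intro h
        refine n2 ?_
        rw [show 1 - (q * a) ^ 2 = (1 - q * a) * (1 + q * a) by ring, h, mul_zero]
    rw [e5]
    generalize hd : 1 - (q * a) ^ 2 = d at n2 ⊢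
    field_simp
    rw [← hd]
    ring

end EvenPart

/-! ### The identity -/

section Identity

variable {q : ℂ}

lemma qPochInf_self_eq (hq : ‖q‖ < 1) : qPochInf q q =
    qPochInf q (q ^ 3) * qPochInf (q ^ 2) (q ^ 3) * qPochInf (q ^ 3) (q ^ 3) := by
  have h3 := norm_pow_lt_one' hq (show 3 ≠ 0 by norm_num)
  have h (n : ℕ) : qPoch q q (3 * n) =
      qPoch q (q ^ 3) n * qPoch (q ^ 2) (q ^ 3) n * qPoch (q ^ 3) (q ^ 3) n := by
    induction n with
    | zero => simp [qPoch_zero]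
    | succ n ih =>
      rw [show 3 * (n + 1) = 3 * n + 1 + 1 + 1 by ring]
      simp only [qPoch_succ, ih, ← pow_mul]
      ring
  have ht : Tendsto (fun n : ℕ => 3 * n) atTop atTop :=
    tendsto_id.const_mul_atTop' (by norm_num)
  refine tendsto_nhds_unique ((tendsto_qPoch hq q).comp ht) ?_
  refine (((tendsto_qPoch h3 q).mul (tendsto_qPoch h3 (q ^ 2))).mul
    (tendsto_qPoch h3 (q ^ 3))).congr fun n => (h n).symm

/-- `J_m = (q^m; q^m)_∞`. -/
lemma J1_eq (hq0 : q ≠ 0) (hq : ‖q‖ < 1) {M : ℕ} (hM : M ≠ 0) :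
    J1 M q = qPochInf (q ^ M) (q ^ M) := by
  have hx := pow_ne_zero M hq0
  rw [qPochInf_self_eq (norm_pow_lt_one' hq hM), J1, J, j, zpow_natCast, mul_comm 3 M, pow_mul]
  congr 3
  field_simp

lemma Jbar_zero (M : ℕ) (q : ℂ) : Jbar 0 M q = j (-1) (q ^ M) := by rw [Jbar, zpow_zero]

lemma neg_one_ne_one : (-1 : ℂ) ≠ 1 := by norm_num

lemma j_neg_one_ne_zero (hq : ‖q‖ < 1) : j (-1) q ≠ 0 :=
  j_ne_zero hq (by simpa using hq) (by simp) neg_one_ne_one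

lemma splitCoeff_zero_eq (hq0 : q ≠ 0) (h : ℕ) :
    -q⁻¹ * (2 * splitCoeff h (-1) (q ^ 8) 0) = appellSum (2 * h + 1) q := by
  rw [splitCoeff, appellSum, Finset.mul_sum, Finset.mul_sum, Finset.mul_sum]
  refine Finset.sum_congr rfl fun r _ => ?_
  have e1 : (((2 * h + 1 : ℕ) : ℤ) - 1) / 2 = h := by push_cast; omega
  have e2 : (q ^ 8) ^ ((2 * h + 1 : ℤ) * (h - r + 0)) =
      q ^ (8 * ((2 * h + 1 : ℕ) : ℤ) * (h - r)) := by
    rw [← zpow_natCast, ← zpow_mul]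
    congr 1
    push_cast
    ring
  have e3 : (q ^ 8) ^ (2 * h + 1) ^ 2 = q ^ (8 * (2 * h + 1) ^ 2) := by rw [← pow_mul]
  have e4 : (thetaTerm 1 (q ^ 8) (r + 1))⁻¹ = -((-1) ^ r * q ^ (-(2 * (r : ℤ) + 1) ^ 2) * q) := by
    have h1 : (-(2 * (r : ℤ) + 1) ^ 2) + 1 = -(8 * ((r + 1) * (r + 1 - 1) / 2)) := by
      linarith [two_mul_tri (r + 1)]
    have h2 : ((-1 : ℂ) ^ r)⁻¹ = (-1) ^ r := by rw [← inv_pow]; norm_num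
    rw [mul_assoc, ← zpow_add_one₀ hq0, h1, thetaTerm, zpow_neg, zpow_mul, one_zpow, mul_one,
      mul_inv, zpow_add_one₀ (by norm_num), zpow_natCast, mul_inv, h2]
    norm_cast
    norm_num
  rw [e1, e2, e3, e4]
  simp only [mul_zero, zpow_zero, one_mul]
  field_simp

/-- The theta part of the splitting of `m(1, q^s; q⁸)`. -/
lemma m_one_pow_eq (hq0 : q ≠ 0) (hq : ‖q‖ < 1) (h : ℕ) {s : ℕ} (hs0 : s ≠ 0) (hs : s < 8) :
    -q⁻¹ * m 1 (q ^ s) (q ^ 8) =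
      -q⁻¹ * splitCoeff h (-1) (q ^ 8) 0 + thetaSum (2 * h + 1) s q := by
  have h80 := pow_ne_zero 8 hq0
  have h8 := norm_pow_lt_one' hq (show 8 ≠ 0 by norm_num)
  have hn {a b : ℕ} (h : b < a) := norm_pow_lt_norm_pow hq0 hq h
  have hl {a : ℕ} (h : a ≠ 0) := norm_pow_lt_one' hq h
  have e1 : (((2 * h + 1 : ℕ) : ℤ) - 1) / 2 = h := by push_cast; omega
  have e3 : (q ^ 8) ^ (2 * h + 1) ^ 2 = q ^ (8 * (2 * h + 1) ^ 2) := by rw [← pow_mul]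
  have e5 : (q ^ 8) ^ (2 * h + 1) = q ^ (8 * (2 * h + 1)) := by rw [← pow_mul]
  have hp0 : q ^ (8 * (2 * h + 1)) ≠ 0 := pow_ne_zero _ hq0
  have hp1 : ‖q ^ (8 * (2 * h + 1))‖ < 1 := hl (by omega)
  rw [m_one_split (h := h) (z := q ^ s) (Z := -1) h80 (hn hs) (hl hs0) (by norm_num)
    (by rw [e3]; exact j_neg_one_ne_zero (hl (by positivity)))
    (by rw [e5]; exact mul_zpow_ne_one hp0 (by simpa using hp1) (by simp) neg_one_ne_one), mul_add]
  congr 1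
  rw [thetaSum, J1_eq hq0 hq (by omega), Jbar_zero, Jbar_zero, J, zpow_natCast, e3, e5, e1,
    ← mul_assoc, Finset.mul_sum, Finset.mul_sum]
  refine Finset.sum_congr rfl fun r hr => ?_
  have hr' := Finset.mem_range.1 hr
  have e6 : (q ^ 8) ^ r * q ^ s = q ^ (8 * r + s) := by rw [← pow_mul, ← pow_add]
  have e7 : (q ^ (8 * r + s)) ^ (2 * h + 1) / -1 = -q ^ ((2 * h + 1) * (8 * r + s)) := by
    rw [← pow_mul, div_neg, div_one, mul_comm]
  have e8 : q⁻¹ * (thetaTerm (q ^ s) (q ^ 8) r * (q ^ (8 * r + s)) ^ (-(h : ℤ))) =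
      (-1) ^ r * q ^ (4 * (r : ℤ) * (r - (2 * h + 1 : ℕ)) - 1) * q ^ ((s : ℤ) * r - s * h) := by
    rw [thetaTerm, ← zpow_natCast, ← zpow_natCast, ← zpow_natCast, ← zpow_mul, ← zpow_mul,
      ← zpow_mul, zpow_natCast (-1) r, mul_assoc ((-1) ^ r), mul_assoc ((-1) ^ r),
      mul_assoc ((-1) ^ r), mul_left_comm, ← zpow_neg_one, ← zpow_add₀ hq0, ← zpow_add₀ hq0,
      ← zpow_add₀ hq0, ← zpow_add₀ hq0]
    congr 2
    push_cast
    linarith [two_mul_tri r]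
  rw [e6, e7, lambert_eq (y := -1) hp0 (hn (by omega)) (hl (by omega)) (by simpa using hp1)
    (by simp) neg_one_ne_one, ← e8, neg_one_mul (q ^ (8 * r + s))]
  ring

lemma V0_eq (hq0 : q ≠ 0) (hq : ‖q‖ < 1) {p : ℕ} (hp : Odd p) :
    V0 q = appellSum p q + thetaSum p 1 q + thetaSum p 3 q := by
  obtain ⟨h, rfl⟩ := hp
  have h1 := m_one_pow_eq hq0 hq h one_ne_zero (by norm_num)
  have h3 := m_one_pow_eq hq0 hq h (s := 3) (by norm_num) (by norm_num)
  rw [pow_one] at h1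
  rw [V0_eq_m_add_m hq0 hq, mul_add, h1, h3, ← splitCoeff_zero_eq hq0]
  ring

end Identity

/-! ### Holomorphic functions on the unit disc -/

section Disc

open Metric

variable {F G : ℂ → ℂ}

/-- `F` agrees on `0 < |q| < 1` with a function that is holomorphic on the whole unit disc. The
value `F 0` is irrelevant. -/
def ExtendsToDisc (F : ℂ → ℂ) : Prop :=
  ∃ H : ℂ → ℂ, DifferentiableOn ℂ H (ball 0 1) ∧ ∀ q, 0 < ‖q‖ → ‖q‖ < 1 → F q = H q

/-- `F` agrees on `0 < |q| < 1` with a function that is holomorphic and has no zero on the whole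
unit disc. -/
def ExtendsToDiscUnit (F : ℂ → ℂ) : Prop :=
  ∃ H : ℂ → ℂ, DifferentiableOn ℂ H (ball 0 1) ∧ (∀ q, ‖q‖ < 1 → H q ≠ 0) ∧
    ∀ q, 0 < ‖q‖ → ‖q‖ < 1 → F q = H q

lemma ExtendsToDiscUnit.extendsToDisc (hF : ExtendsToDiscUnit F) : ExtendsToDisc F :=
  let ⟨H, h1, _, h3⟩ := hF
  ⟨H, h1, h3⟩

lemma ExtendsToDiscUnit.inv (hF : ExtendsToDiscUnit F) : ExtendsToDiscUnit fun q => (F q)⁻¹ := by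
  obtain ⟨H, h1, h2, h3⟩ := hF
  refine ⟨fun q => (H q)⁻¹, h1.inv fun q hq => h2 q (by simpa using hq), fun q hq =>
    inv_ne_zero (h2 q hq), fun q h h' => by simp only [h3 q h h']⟩

lemma ExtendsToDiscUnit.mul (hF : ExtendsToDiscUnit F) (hG : ExtendsToDiscUnit G) :
    ExtendsToDiscUnit fun q => F q * G q := by
  obtain ⟨H, h1, h2, h3⟩ := hF
  obtain ⟨K, k1, k2, k3⟩ := hG
  exact ⟨fun q => H q * K q, h1.mul k1, fun q hq => mul_ne_zero (h2 q hq) (k2 q hq),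
    fun q h h' => by simp only [h3 q h h', k3 q h h']⟩

lemma ExtendsToDisc.mul (hF : ExtendsToDisc F) (hG : ExtendsToDisc G) :
    ExtendsToDisc fun q => F q * G q := by
  obtain ⟨H, h1, h2⟩ := hF
  obtain ⟨K, k1, k2⟩ := hG
  exact ⟨fun q => H q * K q, h1.mul k1, fun q h h' => by simp only [h2 q h h', k2 q h h']⟩

lemma differentiableOn_ball_of_lt
    (h : ∀ ρ : ℝ, 0 < ρ → ρ < 1 → DifferentiableOn ℂ F (ball 0 ρ)) :
    DifferentiableOn ℂ F (ball 0 1) := by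
  intro q hq
  obtain ⟨ρ, h1, h2⟩ := exists_between (mem_ball_zero_iff.1 hq)
  exact ((h ρ ((norm_nonneg _).trans_lt h1) h2).differentiableAt
    (isOpen_ball.mem_nhds (mem_ball_zero_iff.2 h1))).differentiableWithinAt

/-! ### Theta functions and Appell functions on the unit disc -/

lemma differentiableOn_qPochInf {ε : ℂ} (hε : ‖ε‖ ≤ 1) {e M : ℕ} (hM : M ≠ 0) :
    DifferentiableOn ℂ (fun q => qPochInf (ε * q ^ e) (q ^ M)) (ball 0 1) := by
  refine differentiableOn_ball_of_lt fun ρ h0 h1 => ?_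
  have hd (i : ℕ) : DifferentiableOn ℂ (fun q : ℂ => -((q ^ M) ^ i * (ε * q ^ e))) (ball 0 ρ) := by
    fun_prop
  have h := (summable_geometric_of_lt_one h0.le h1).hasProdLocallyUniformlyOn_nat_one_add
    (f := fun i q => -((q ^ M) ^ i * (ε * q ^ e))) isOpen_ball
    (Eventually.of_forall fun i q hq => ?_) fun i => (hd i).continuousOn
  · have h2 := h.differentiableOn (Eventually.of_forall fun s =>
      DifferentiableOn.fun_finsetProd fun i _ => (differentiableOn_const 1).add (hd i)) isOpen_ball
    simpa only [qPochInf, sub_eq_add_neg] using h2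
  · have hq' : ‖q‖ < ρ := mem_ball_zero_iff.1 hq
    rw [norm_neg, norm_mul, norm_mul, norm_pow, norm_pow, norm_pow, ← pow_mul]
    have h2 : ‖q‖ ^ (M * i) ≤ ‖q‖ ^ i := pow_le_pow_of_le_one (norm_nonneg _) (hq'.le.trans h1.le)
      (Nat.le_mul_of_pos_left _ (Nat.pos_of_ne_zero hM))
    have h3 : ‖q‖ ^ i ≤ ρ ^ i := pow_le_pow_left₀ (norm_nonneg _) hq'.le i
    have h4 : ‖ε‖ * ‖q‖ ^ e ≤ 1 :=
      mul_le_one₀ hε (by positivity) (pow_le_one₀ (norm_nonneg _) (hq'.le.trans h1.le))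
    calc _ ≤ ρ ^ i * 1 := mul_le_mul (h2.trans h3) h4 (by positivity) (by positivity)
      _ = ρ ^ i := mul_one _

lemma qPochInf_mul_pow_ne_zero {ε : ℂ} (hε : ‖ε‖ ≤ 1) {e M : ℕ} (he : e ≠ 0) (hM : M ≠ 0) {q : ℂ}
    (hq : ‖q‖ < 1) : qPochInf (ε * q ^ e) (q ^ M) ≠ 0 := by
  refine qPochInf_ne_zero_of_norm_lt (norm_pow_lt_one' hq hM) ?_
  rw [norm_mul]
  exact (mul_le_of_le_one_left (norm_nonneg _) hε).trans_lt (norm_pow_lt_one' hq he)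

lemma extendsToDiscUnit_qPochInf {ε : ℂ} (hε : ‖ε‖ ≤ 1) {e M : ℕ} (he : e ≠ 0) (hM : M ≠ 0) :
    ExtendsToDiscUnit fun q => qPochInf (ε * q ^ e) (q ^ M) :=
  ⟨_, differentiableOn_qPochInf hε hM, fun _ hq => qPochInf_mul_pow_ne_zero hε he hM hq,
    fun _ _ _ => rfl⟩

lemma ExtendsToDiscUnit.congr (hF : ExtendsToDiscUnit F)
    (h : ∀ q, 0 < ‖q‖ → ‖q‖ < 1 → G q = F q) : ExtendsToDiscUnit G := by
  obtain ⟨H, h1, h2, h3⟩ := hF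
  exact ⟨H, h1, h2, fun q hq hq' => (h q hq hq').trans (h3 q hq hq')⟩

lemma extendsToDiscUnit_j {ε : ℂ} (hε : ε * ε = 1) {a M : ℕ} (ha : a ≠ 0) (haM : a < M) :
    ExtendsToDiscUnit fun q => j (ε * q ^ a) (q ^ M) := by
  have h1 : ‖ε‖ ≤ 1 := by
    have h2 : ‖ε‖ * ‖ε‖ = 1 := by rw [← norm_mul, hε, norm_one]
    nlinarith [norm_nonneg ε]
  have hM : M ≠ 0 := by omega
  refine (((extendsToDiscUnit_qPochInf h1 ha hM).mul
    (extendsToDiscUnit_qPochInf h1 (e := M - a) (by omega) hM)).mul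
    (extendsToDiscUnit_qPochInf (ε := 1) (by simp) hM hM)).congr fun q hq _ => ?_
  have hq0 : q ≠ 0 := norm_pos_iff.1 hq
  have hε0 : ε ≠ 0 := left_ne_zero_of_mul_eq_one hε
  have e1 : q ^ M / (ε * q ^ a) = ε * q ^ (M - a) := by
    rw [div_eq_iff (mul_ne_zero hε0 (pow_ne_zero _ hq0)), mul_mul_mul_comm, hε, one_mul, ← pow_add,
      Nat.sub_add_cancel haM.le]
  rw [j, e1, one_mul]

lemma extendsToDiscUnit_j_neg_one {M : ℕ} (hM : M ≠ 0) :
    ExtendsToDiscUnit fun q => j (-1) (q ^ M) := by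
  have h1 : ExtendsToDiscUnit fun _ => 2 :=
    ⟨_, differentiableOn_const 2, fun _ _ => two_ne_zero, fun _ _ _ => rfl⟩
  have h2 := extendsToDiscUnit_qPochInf (ε := -1) (by simp) hM hM
  refine (((h1.mul h2).mul h2).mul
    (extendsToDiscUnit_qPochInf (ε := 1) (by simp) hM hM)).congr fun q _ hq => ?_
  rw [j, qPochInf_eq_mul (norm_pow_lt_one' hq hM), div_neg, div_one, one_mul, neg_one_mul,
    mul_neg_one, sub_neg_eq_add, one_add_one_eq_two]

lemma extendsToDiscUnit_J1 {M : ℕ} (hM : M ≠ 0) : ExtendsToDiscUnit (J1 M) :=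
  (extendsToDiscUnit_qPochInf (ε := 1) (by simp) hM hM).congr fun q hq hq' => by
    rw [J1_eq (norm_pos_iff.1 hq) hq' hM, one_mul]

/-- The general term of `j(-1; x^p) m(x^k, -1; x^p)` is
`x^{p r(r-1)/2} / (1 + x^e)` with `e = p (r - 1) + k`. For `e < 0` numerator and denominator are
multiplied by `x^{-e}`. -/
lemma extendsToDisc_m {p : ℕ} (hp : p ≠ 0) (k : ℤ) :
    ExtendsToDisc fun x => m (x ^ k) (-1) (x ^ p) := by
  have hj := ((extendsToDiscUnit_j_neg_one hp).inv).extendsToDisc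
  set e : ℤ → ℤ := fun r => p * (r - 1) + k with he
  set f : ℤ → ℂ → ℂ := fun r x =>
    x ^ ((r * (r - 1) / 2).toNat * p + (-e r).toNat) / (1 + x ^ (e r).natAbs) with hf
  have htri (r : ℤ) : 0 ≤ r * (r - 1) / 2 := by
    have h : 0 ≤ r * (r - 1) := by
      rcases lt_or_ge r 1 with h | h <;> nlinarith
    omega
  have hden {ρ : ℝ} (h1 : ρ < 1) (r : ℤ) {x : ℂ} (hx : ‖x‖ ≤ ρ) :
      1 - ρ ≤ ‖1 + x ^ (e r).natAbs‖ := by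
    rcases eq_or_ne (e r).natAbs 0 with h | h
    · have h0 := (norm_nonneg x).trans hx
      rw [h, pow_zero, one_add_one_eq_two, RCLike.norm_ofNat]
      linarith
    · have h2 : ‖x ^ (e r).natAbs‖ ≤ ρ := by
        rw [norm_pow]
        exact (pow_le_of_le_one (norm_nonneg _) (hx.trans h1.le) h).trans hx
      have h3 := norm_sub_norm_le (1 : ℂ) (-x ^ (e r).natAbs)
      rw [norm_neg, norm_one, sub_neg_eq_add] at h3
      linarith
  have hdiff : DifferentiableOn ℂ (fun x => ∑' r, f r x) (ball 0 1) := by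
    refine differentiableOn_ball_of_lt fun ρ h0 h1 => ?_
    have hs := (summable_norm_thetaTerm (q := (ρ : ℂ)) (z := 1) (by exact_mod_cast h0.ne')
      (by rwa [Complex.norm_real, Real.norm_of_nonneg h0.le]) one_ne_zero).mul_right (1 - ρ)⁻¹
    refine Complex.differentiableOn_tsum_of_summable_norm hs (fun r => ?_) isOpen_ball
      fun r x hx => ?_
    · refine DifferentiableOn.div (by fun_prop) (by fun_prop) fun x hx => ?_
      have := hden h1 r (mem_ball_zero_iff.1 hx).le
      exact norm_pos_iff.1 (lt_of_lt_of_le (by linarith) this)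
    · have hx' := mem_ball_zero_iff.1 hx
      have hpos : 0 < 1 - ρ := by linarith
      simp only [hf]
      rw [norm_div, div_eq_mul_inv]
      gcongr
      · rw [thetaTerm, one_zpow, mul_one, norm_mul, norm_zpow, norm_neg, norm_one, one_zpow, one_mul,
          norm_zpow, Complex.norm_real, Real.norm_of_nonneg h0.le, norm_pow]
        obtain ⟨n, hn⟩ := Int.eq_ofNat_of_zero_le (htri r)
        rw [hn, zpow_natCast, Int.toNat_natCast]
        calc ‖x‖ ^ (n * p + (-e r).toNat) ≤ ‖x‖ ^ n :=
              pow_le_pow_of_le_one (norm_nonneg _) (hx'.le.trans h1.le)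
                (le_add_right (Nat.le_mul_of_pos_right _ (Nat.pos_of_ne_zero hp)))
          _ ≤ ρ ^ n := pow_le_pow_left₀ (norm_nonneg _) hx'.le n
      · exact hden h1 r hx'.le
  have hsum : ExtendsToDisc fun x => ∑' r : ℤ,
      thetaTerm (-1) (x ^ p) r / (1 - (x ^ p) ^ (r - 1) * x ^ k * (-1)) := by
    refine ⟨_, hdiff, fun x hx hx1 => tsum_congr fun r => ?_⟩
    have hx0 : x ≠ 0 := norm_pos_iff.1 hx
    have e1 : (x ^ p) ^ (r - 1) * x ^ k = x ^ e r := by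
      rw [← zpow_natCast, ← zpow_mul, ← zpow_add₀ hx0]
    have e2 : thetaTerm (-1) (x ^ p) r = x ^ ((r * (r - 1) / 2).toNat * p) := by
      obtain ⟨n, hn⟩ := Int.eq_ofNat_of_zero_le (htri r)
      have h1 : ((-1 : ℂ) ^ r) * (-1) ^ r = 1 := by rw [← mul_zpow]; simp
      rw [thetaTerm, mul_right_comm, h1, one_mul, hn, zpow_natCast, Int.toNat_natCast, ← pow_mul,
        mul_comm]
    rw [e1, e2, mul_neg_one, sub_neg_eq_add]
    simp only [hf]
    rcases le_or_gt 0 (e r) with h | h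
    · rw [Int.toNat_of_nonpos (by omega : -e r ≤ 0), add_zero]
      congr 2
      rw [← zpow_natCast]
      congr 1
      omega
    · have e3 : (-e r).toNat = (e r).natAbs := by omega
      have e4 : x ^ e r = (x ^ (e r).natAbs)⁻¹ := by
        rw [← zpow_natCast, ← zpow_neg]
        congr 1
        omega
      have h5 := hden hx1 r le_rfl
      have h6 : 1 + x ^ (e r).natAbs ≠ 0 := norm_pos_iff.1 (lt_of_lt_of_le (by linarith) h5)
      have h7 := pow_ne_zero (e r).natAbs hx0
      rw [e3, e4, pow_add]
      generalize x ^ (e r).natAbs = y at *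
      have h8 : 1 + y⁻¹ = (1 + y) / y := by field_simp; ring
      rw [h8]
      field_simp
  simpa only [m_eq, one_div] using hj.mul hsum

/-! ### Laurent expansions -/

lemma hasSum_taylor {H : ℂ → ℂ} (hH : DifferentiableOn ℂ H (ball 0 1)) {q : ℂ} (hq : ‖q‖ < 1) :
    HasSum (fun n : ℕ => iteratedDeriv n H 0 / (n.factorial : ℂ) * q ^ n) (H q) := by
  refine (Complex.hasSum_taylorSeries_on_ball hH (mem_ball_zero_iff.2 hq)).of_eq (fun n => ?_) rfl
  rw [sub_zero, smul_eq_mul, smul_eq_mul]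
  ring

/-- The Laurent series of `q^E F(q^d)` is supported on the residue class of `E` modulo `d`. -/
lemma exists_laurent (hF : ExtendsToDisc F) (E : ℤ) {d : ℕ} (hd : d ≠ 0) :
    ∃ c : ℤ → ℂ, IsLaurentExpansion (fun q => q ^ E * F (q ^ d)) c ∧
      ∀ n, ¬ n ≡ E [ZMOD d] → c n = 0 := by
  obtain ⟨H, h1, h2⟩ := hF
  set i : ℕ → ℤ := fun k => E + d * k with hi
  have hinj : Function.Injective i := fun a b hab => by
    have h : (d : ℤ) * a = d * b := by simpa [hi] using hab
    exact_mod_cast mul_left_cancel₀ (by exact_mod_cast hd) h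
  refine ⟨Function.extend i (fun k => iteratedDeriv k H 0 / (k.factorial : ℂ)) 0,
    fun q hq hq' => ?_, fun n hn => ?_⟩
  · have hq0 : q ≠ 0 := norm_pos_iff.1 hq
    beta_reduce
    rw [h2 _ (norm_pos_iff.2 (pow_ne_zero d hq0)) (norm_pow_lt_one' hq' hd),
      ← hinj.hasSum_iff fun n hn => ?_]
    · refine ((hasSum_taylor h1 (norm_pow_lt_one' hq' hd)).mul_left (q ^ E)).of_eq (fun k => ?_) rfl
      rw [Function.comp, hinj.extend_apply, zpow_add₀ hq0, zpow_mul, zpow_natCast, zpow_natCast]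
      ring
    · rw [Function.extend_apply' _ _ _ hn, Pi.zero_apply, zero_mul]
  · rw [Function.extend_apply', Pi.zero_apply]
    rintro ⟨k, rfl⟩
    refine hn ?_
    rw [Int.modEq_iff_dvd]
    exact ⟨-k, by ring⟩

lemma IsLaurentExpansion.sub {a b : ℤ → ℂ} (hF : IsLaurentExpansion F a)
    (hG : IsLaurentExpansion G b) :
    IsLaurentExpansion (fun q => F q - G q) fun n => a n - b n := fun q h h' =>
  ((hF q h h').sub (hG q h h')).of_eq (fun n => by rw [sub_mul]) rfl

lemma IsLaurentExpansion.sum {ι : Type*} {s : Finset ι} {f : ι → ℂ → ℂ} {c : ι → ℤ → ℂ} (w : ι → ℂ)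
    (h : ∀ i, IsLaurentExpansion (f i) (c i)) :
    IsLaurentExpansion (fun q => ∑ i ∈ s, w i * f i q) fun n => ∑ i ∈ s, w i * c i n :=
  fun q hq hq' => (hasSum_sum fun i _ => (h i q hq hq').mul_left (w i)).of_eq
    (fun n => by rw [Finset.sum_mul]; exact Finset.sum_congr rfl fun i _ => by ring) rfl

lemma IsLaurentExpansion.congr {c : ℤ → ℂ} (hF : IsLaurentExpansion F c)
    (h : ∀ q, 0 < ‖q‖ → ‖q‖ < 1 → G q = F q) : IsLaurentExpansion G c :=
  fun q hq hq' => by rw [h q hq hq']; exact hF q hq hq'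

lemma exists_laurent_appellSum {p : ℕ} (hp : p ≠ 0) :
    ∃ a : ℤ → ℂ, IsLaurentExpansion (appellSum p) a ∧
      ∀ n, (∀ r : ℕ, r < p → ¬ n ≡ -(2 * (r : ℤ) + 1) ^ 2 [ZMOD 8 * (p : ℤ)]) → a n = 0 := by
  choose c h1 h2 using fun r : ℕ => exists_laurent
    (extendsToDisc_m hp (((p : ℤ) - 1) / 2 - r)) (-(2 * (r : ℤ) + 1) ^ 2)
    (d := 8 * p) (by omega)
  refine ⟨_, (IsLaurentExpansion.sum (s := Finset.range p) (fun r => -2 * (-1) ^ r) h1).congr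
    fun q _ _ => ?_, fun n hn => Finset.sum_eq_zero fun r hr => ?_⟩
  · rw [appellSum, Finset.mul_sum]
    refine Finset.sum_congr rfl fun r _ => ?_
    have e1 : (q ^ (8 * p)) ^ (((p : ℤ) - 1) / 2 - r) =
        q ^ (8 * (p : ℤ) * (((p : ℤ) - 1) / 2 - r)) := by
      rw [zpow_mul, ← zpow_natCast]
      push_cast
      rfl
    have e2 : (q ^ (8 * p)) ^ p = q ^ (8 * p ^ 2) := by rw [← pow_mul]; ring_nf
    rw [e1, e2]
    ring
  · rw [h2 r n (by push_cast; exact hn r (Finset.mem_range.1 hr)), mul_zero]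

lemma exists_laurent_thetaSum {p s : ℕ} (hs0 : s ≠ 0) (hs : s < 8) :
    ∃ c : ℤ → ℂ, IsLaurentExpansion (thetaSum p s) c := by
  rcases eq_or_ne p 0 with rfl | hp
  · exact ⟨0, fun q _ _ => by simp [thetaSum]⟩
  have hJ1 := extendsToDiscUnit_J1 (M := 8 * p) (by omega)
  have hJs : ExtendsToDiscUnit (J s 8) :=
    (extendsToDiscUnit_j (ε := 1) (by norm_num) hs0 hs).congr fun q _ _ => by
      rw [J, zpow_natCast, one_mul]
  have hJb {M : ℕ} (hM : M ≠ 0) : ExtendsToDiscUnit (Jbar 0 M) :=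
    (extendsToDiscUnit_j_neg_one hM).congr fun q _ _ => Jbar_zero M q
  have hpre := (((hJ1.mul hJ1).mul hJ1).mul (hJs.mul (hJb (M := 8 * p ^ 2) (by positivity))).inv).mul
    (hJb (M := 8 * p) (by omega)).inv
  have hterm (r : Fin p) : ExtendsToDisc _ := (hpre.mul (((extendsToDiscUnit_j (ε := -1)
    (a := 8 * r + s) (M := 8 * p) (by norm_num) (by omega) (by omega)).mul
    (extendsToDiscUnit_j (ε := -1) (a := p * (8 * r + s)) (M := 8 * p ^ 2) (by norm_num)
      (by have := Nat.pos_of_ne_zero hp; positivity)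
      (by
        have h : p * (8 * r + s) < p * (8 * p) :=
          Nat.mul_lt_mul_of_pos_left (by omega) (Nat.pos_of_ne_zero hp)
        calc _ < _ := h
          _ = _ := by ring))).mul
    (extendsToDiscUnit_j (ε := 1) (a := 8 * r + s) (M := 8 * p) (by norm_num) (by omega)
      (by omega)).inv)).extendsToDisc
  choose c h1 _ using fun r : Fin p => exists_laurent (hterm r)
    (4 * (r : ℤ) * ((r : ℤ) - p) - 1 + ((s : ℤ) * r - (s : ℤ) * (((p : ℤ) - 1) / 2))) one_ne_zero
  refine ⟨_, (IsLaurentExpansion.sum (s := Finset.univ) (fun r : Fin p => (-1) ^ (r : ℕ)) h1).congr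
    fun q hq _ => ?_⟩
  have hq0 : q ≠ 0 := norm_pos_iff.1 hq
  rw [thetaSum, Finset.sum_range, Finset.mul_sum]
  refine Finset.sum_congr rfl fun r _ => ?_
  simp only [pow_one, neg_one_mul, one_mul]
  rw [zpow_add₀ hq0, div_eq_mul_inv, div_eq_mul_inv, mul_inv (Jbar 0 (8 * p) q)]
  ring

lemma differentiableOn_V0 : DifferentiableOn ℂ V0 (ball 0 1) := by
  have h : DifferentiableOn ℂ (fun q => ∑' n, fTerm q 1 n) (ball 0 1) := by
    refine differentiableOn_ball_of_lt fun ρ h0 h1 => ?_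
    have hs := summable_pow_sq_mul h0.le h1 (K := 2 * (1 - ρ)⁻¹)
      (mul_nonneg zero_le_two (inv_nonneg.2 (by linarith)))
    refine Complex.differentiableOn_tsum_of_summable_norm hs (fun n => ?_) isOpen_ball
      fun n q hq => ?_
    · have hp (ε : ℂ) : DifferentiableOn ℂ (fun q => qPoch (ε * q) (q ^ 2) n) (ball 0 ρ) := by
        unfold qPoch
        exact DifferentiableOn.fun_finsetProd fun i _ => by fun_prop
      have hp1 := hp 1
      have hp2 := hp (-1)
      simp only [one_mul, neg_one_mul] at hp1 hp2
      simp only [fTerm, one_pow, one_mul]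
      refine DifferentiableOn.div (DifferentiableOn.mul (by fun_prop) hp2) hp1 fun q hq => ?_
      have hq' := (mem_ball_zero_iff.1 hq).trans h1
      exact qPoch_ne_zero (norm_sq_lt_one hq') hq' n
    · have hq' := mem_ball_zero_iff.1 hq
      refine (norm_fTerm_le (hq'.trans h1) (by simp) n).trans ?_
      have h2 : 0 < 1 - ρ := by linarith
      have h3 : 0 ≤ (1 - ‖q‖)⁻¹ := inv_nonneg.2 (by linarith)
      have h4 : 0 ≤ 2 * (1 - ‖q‖)⁻¹ := mul_nonneg zero_le_two h3
      have h5 : (1 - ‖q‖)⁻¹ ≤ (1 - ρ)⁻¹ := inv_anti₀ h2 (by linarith)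
      exact mul_le_mul (pow_le_pow_left₀ (norm_nonneg _) hq'.le _)
        (pow_le_pow_left₀ h4 (by linarith) n) (pow_nonneg h4 n) (by positivity)
  refine ((h.const_mul 2).const_add (-1)).congr fun q _ => ?_
  rw [V0]
  simp only [fTerm, one_pow, one_mul]

lemma hasSum_g {q : ℂ} (hq : ‖q‖ < 1) : HasSum (fun n : ℕ => g n * q ^ n) (V0 q) :=
  (hasSum_taylor differentiableOn_V0 hq).of_eq (fun n => by simp [g]) rfl

lemma isLaurentExpansion_V0 : IsLaurentExpansion V0 g := by
  intro q _ hq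
  rw [← (Nat.cast_injective (R := ℤ)).hasSum_iff fun n hn => ?_]
  · exact (hasSum_g hq).of_eq (fun n => by simp) rfl
  · rw [g, if_neg, zero_mul]
    intro h
    exact hn ⟨n.toNat, by omega⟩

end Disc

end MockV0

end

theorem theorem1p2 (p : ℕ) (hp : 3 ≤ p) (hodd : Odd p) :
    -- `V₀(q) = ∑_{n ≥ 0} g(n) q^n`
    (∀ q : ℂ, ‖q‖ < 1 → HasSum (fun n : ℕ => MockV0.g n * q ^ n) (MockV0.V0 q)) ∧
    -- the identity
    (∀ q : ℂ, 0 < ‖q‖ → ‖q‖ < 1 →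
      MockV0.V0 q =
        MockV0.appellSum p q + MockV0.thetaSum p 1 q + MockV0.thetaSum p 3 q) ∧
    -- only the two theta sums contribute to `∑ g(8pn+α) q^{8pn+α}`
    (∃ a c₁ c₃ : ℤ → ℂ,
      MockV0.IsLaurentExpansion (MockV0.appellSum p) a ∧
      MockV0.IsLaurentExpansion (MockV0.thetaSum p 1) c₁ ∧
      MockV0.IsLaurentExpansion (MockV0.thetaSum p 3) c₃ ∧
      ∀ α : ℤ, (∀ r : ℕ, r < p → ¬ α ≡ -(2 * (r : ℤ) + 1) ^ 2 [ZMOD 8 * (p : ℤ)]) →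
        (∀ n : ℤ, a (8 * p * n + α) = 0) ∧
        (∀ n : ℤ, MockV0.g (8 * p * n + α) = c₁ (8 * p * n + α) + c₃ (8 * p * n + α)) ∧
        (∀ q : ℂ, 0 < ‖q‖ → ‖q‖ < 1 →
          HasSum (fun n : ℕ => MockV0.g (8 * p * n + α) * q ^ (8 * p * n + α : ℤ))
            (∑' n : ℕ, (c₁ (8 * p * n + α) + c₃ (8 * p * n + α)) *
              q ^ (8 * p * n + α : ℤ)))) := by
  have hid (q : ℂ) (h : 0 < ‖q‖) (h' : ‖q‖ < 1) :=
    MockV0.V0_eq (norm_pos_iff.1 h) h' hodd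
  refine ⟨fun q hq => MockV0.hasSum_g hq, hid, ?_⟩
  obtain ⟨a, ha, ha0⟩ := MockV0.exists_laurent_appellSum (p := p) (by omega)
  obtain ⟨c₁, h1⟩ := MockV0.exists_laurent_thetaSum (p := p) one_ne_zero (by norm_num)
  -- By the identity, the third expansion is what remains of the expansion of `V₀`.
  have h3 : MockV0.IsLaurentExpansion (MockV0.thetaSum p 3)
      (fun n => MockV0.g n - a n - c₁ n) :=
    ((MockV0.isLaurentExpansion_V0.sub ha).sub h1).congr fun q h h' => by
      rw [hid q h h']; ring
  refine ⟨a, c₁, _, ha, h1, h3, fun α hα => ?_⟩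
  have hα0 (n : ℤ) : a (8 * p * n + α) = 0 := by
    refine ha0 _ fun r hr h => hα r hr (Int.ModEq.trans ?_ h)
    rw [Int.modEq_iff_dvd]
    exact ⟨n, by ring⟩
  have hg (n : ℤ) : MockV0.g (8 * p * n + α) = c₁ (8 * p * n + α) +
      (MockV0.g (8 * p * n + α) - a (8 * p * n + α) - c₁ (8 * p * n + α)) := by
    rw [hα0]; ring
  refine ⟨hα0, hg, fun q h h' => ?_⟩
  have hinj : Function.Injective fun n : ℕ => 8 * (p : ℤ) * n + α := fun m n hmn => by
    have hmn' : 8 * (p : ℤ) * m = 8 * p * n := by simpa using hmn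
    exact_mod_cast mul_left_cancel₀ (by positivity) hmn'
  simp only [← hg]
  exact ((MockV0.isLaurentExpansion_V0 q h h').summable.comp_injective hinj).hasSum
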